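/- Let $\Gamma$ be a connected compact metric graph, that is, a graph with finitely many vertices and finitely many edges (at least one; loops and multiple edges are allowed), in which each edge $e$ is identified with an interval $[0,\ell_e]$, $0<\ell_e<\infty$. Let $V_D$ be a non-empty set of vertices. A function on $\Gamma$ is a family $u=(u_e)_e$ of functions on the edges, $\int_\Gamma u\,dx=\sum_e\int_0^{\ell_e}u_e\,dx$, and $W^{1,p}(\Gamma)$ is the space of continuous functions $u$ on $\Gamma$ with $u_e\in W^{1,p}(0,\ell_e)$ for every edge $e$. For $1<p<\infty$ put $$\lambda_{1,p}(\Gamma,V_D)=\inf\left\{\frac{\int_\Gamma|u'|^p\,dx}{\int_\Gamma|u|^p\,dx}\colon u\in W^{1,p}(\Gamma),\ u=0\text{ on }V_D,\ u\ne0\right\}.$$ A function $v\in BV(\Gamma)$ is an $L^1$ function on the edges together with values $v(\mathrm v)\in\mathbb R$ at the vertices $\mathrm v$, such that $$|Dv|(\Gamma)=\sum_e|D\tilde v_e|(\mathbb R)<\infty,$$ where $\tilde v_e$ is equal to $v_e$ on $(0,\ell_e)$ and is extended to the left and to the right of this interval by the values of $v$ at the initial and at the terminal vertex of $e$; thus jumps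 at the vertices (also at those in $V_D$) are counted. An element of $L^1(\Gamma)$ is regarded as such a function by a choice of vertex values. Put $$\Lambda_1(\Gamma,V_D)=\inf\left\{\frac{|Dv|(\Gamma)}{\|v\|_{L^1(\Gamma)}}\colon v\in BV(\Gamma),\ v(\mathrm v)=0\text{ for all }\mathrm v\in V_D,\ v\ne0\text{ in }L^1(\Gamma)\right\}.$$ Then $$\lim_{p\to1^+}\lambda_{1,p}(\Gamma,V_D)=\Lambda_1(\Gamma,V_D).$$ Moreover, for each $p>1$ let $u_p$ be a minimizer for $\lambda_{1,p}(\Gamma,V_D)$ with $\|u_p\|_{L^1(\Gamma)}=1$. Then there are a sequence $p_j\to1^+$ and a function $u_1\in L^1(\Gamma)$ such that $u_{p_j}\to u_1$ in $L^1(\Gamma)$. Furthermore, whenever $p_j\to1^+$ and $u_{p_j}\to u_1$ in $L^1(\Gamma)$, the function $u_1$, with suitable values at the vertices that vanish on $V_D$, is a minimizer for $\Lambda_1(\Gamma,V_D)$. -/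

import Mathlib

open MeasureTheory Filter Topology Set
open scoped ContDiff ENNReal

noncomputable section

/-- A metric graph with vertex set `V` and edge set `E`, all of whose edges have finite positive
length. The edge `e` is identified with the interval `[0, len e]`, the coordinate increasing from
the initial vertex `init e` to the terminal vertex `term e`. Loops and multiple edges are allowed.
The graph is compact when `V` and `E` are finite. -/
structure MetricGraph (V E : Type*) where
  init : E → V
  term : E → V
  len : E → ℝ
  len_pos : ∀ e, 0 < len e

/-- The total variation on the real line of (the distributional derivative of) a locally
integrable function: the supremum of `∫ f φ'` over compactly supported `C¹` functions `φ` with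
values in `[-1, 1]`. -/
def lineVariation (f : ℝ → ℝ) : ℝ≥0∞ :=
  ⨆ (φ : ℝ → ℝ) (_ : ContDiff ℝ 1 φ ∧ HasCompactSupport φ ∧ ∀ x, |φ x| ≤ 1),
    ENNReal.ofReal (∫ x, f x * deriv φ x)

/-- `g` is a weak derivative of `f` on the interval `(0, l)`. -/
def IsWeakDeriv (l : ℝ) (f g : ℝ → ℝ) : Prop :=
  ∀ φ : ℝ → ℝ, ContDiff ℝ ∞ φ → HasCompactSupport φ → tsupport φ ⊆ Ioo 0 l →
    ∫ x in Ioo 0 l, f x * deriv φ x = - ∫ x in Ioo 0 l, g x * φ x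

namespace MetricGraph

variable {V E : Type*}

/-- Any two vertices are joined by a walk (edges may be traversed in both directions). -/
def Connected (Γ : MetricGraph V E) : Prop :=
  ∀ v w : V, Relation.EqvGen (fun a b => ∃ e, Γ.init e = a ∧ Γ.term e = b) v w

/-- Lebesgue measure on the open edge `(0, len e)`. -/
def edgeMeasure (Γ : MetricGraph V E) (e : E) : Measure ℝ :=
  volume.restrict (Ioo 0 (Γ.len e))

/-- The function `u` on `Γ`, given by its restrictions to the edges, belongs to `L¹(Γ)`. -/
def MemL1 (Γ : MetricGraph V E) (u : E → ℝ → ℝ) : Prop :=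
  ∀ e, Integrable (u e) (Γ.edgeMeasure e)

/-- `∫_Γ |u|^p`, the sum of the integrals over the edges. -/
def powIntegral [Fintype E] (Γ : MetricGraph V E) (p : ℝ) (u : E → ℝ → ℝ) : ℝ :=
  ∑ e, ∫ x, |u e x| ^ p ∂(Γ.edgeMeasure e)

/-- The norm of `L¹(Γ)`. -/
def normL1 [Fintype E] (Γ : MetricGraph V E) (u : E → ℝ → ℝ) : ℝ :=
  ∑ e, ∫ x, |u e x| ∂(Γ.edgeMeasure e)

/-- `u` is a continuous function on `Γ` and `c v` is its value at the vertex `v`. -/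
def IsContinuous (Γ : MetricGraph V E) (u : E → ℝ → ℝ) (c : V → ℝ) : Prop :=
  ∀ e, ContinuousOn (u e) (Icc 0 (Γ.len e)) ∧
    u e 0 = c (Γ.init e) ∧ u e (Γ.len e) = c (Γ.term e)

/-- `u` is a nonzero element of
`X(Γ, D) = {u ∈ W^{1,p}(Γ) : u = 0 on D}`, with weak derivative `u'`. Functions
in `W^{1,p}(Γ)` are by definition continuous on `Γ`. -/
def IsAdmissible (Γ : MetricGraph V E) (D : Set V) (p : ℝ) (u u' : E → ℝ → ℝ) : Prop :=
  (∃ c : V → ℝ, Γ.IsContinuous u c ∧ ∀ v ∈ D, c v = 0) ∧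
  (∀ e, MemLp (u e) (ENNReal.ofReal p) (Γ.edgeMeasure e) ∧
    MemLp (u' e) (ENNReal.ofReal p) (Γ.edgeMeasure e) ∧
    IsWeakDeriv (Γ.len e) (u e) (u' e)) ∧
  ∃ e, ∃ x ∈ Icc 0 (Γ.len e), u e x ≠ 0

/-- The first eigenvalue `λ_{1,p}(Γ, D)` of the `p`-Laplacian. -/
def firstEigenvalue [Fintype E] (Γ : MetricGraph V E) (D : Set V) (p : ℝ) : ℝ :=
  sInf {r : ℝ | ∃ u u' : E → ℝ → ℝ, Γ.IsAdmissible D p u u' ∧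
    r = Γ.powIntegral p u' / Γ.powIntegral p u}

/-- `u` is a minimizer for `λ_{1,p}(Γ, D)`. -/
def IsFirstEigenfunction [Fintype E] (Γ : MetricGraph V E) (D : Set V) (p : ℝ)
    (u : E → ℝ → ℝ) : Prop :=
  ∃ u' : E → ℝ → ℝ, Γ.IsAdmissible D p u u' ∧
    Γ.powIntegral p u' / Γ.powIntegral p u = Γ.firstEigenvalue D p

/-- The function on the line equal to `v` on the open edge `e`, and extended beyond the ends of
the edge by the values `c` at its end vertices. -/
def edgeExtension (Γ : MetricGraph V E) (v : E → ℝ → ℝ) (c : V → ℝ) (e : E) : ℝ → ℝ :=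
  fun x => if x ≤ 0 then c (Γ.init e) else if x < Γ.len e then v e x else c (Γ.term e)

/-- `|Dv|(Γ)` for the function `v` with vertex values `c`: the sum over the edges of the total
variation on the closed edge. Jumps at the vertices, between the value at the vertex and the trace
along each incident edge, are counted. -/
def totalVariation [Fintype E] (Γ : MetricGraph V E) (v : E → ℝ → ℝ) (c : V → ℝ) : ℝ≥0∞ :=
  ∑ e, lineVariation (Γ.edgeExtension v c e)

/-- `v`, with vertex values `c`, is a function in `BV(Γ)` that vanishes on `D` and is nonzero (as
an element of `L¹(Γ)`). -/
def IsAdmissibleBV [Fintype E] (Γ : MetricGraph V E) (D : Set V) (v : E → ℝ → ℝ) (c : V → ℝ) :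
    Prop :=
  Γ.MemL1 v ∧ Γ.totalVariation v c < ⊤ ∧ (∀ w ∈ D, c w = 0) ∧
    ∃ e, ¬ v e =ᵐ[Γ.edgeMeasure e] 0

/-- `Λ₁(Γ, D)`, the infimum of `|Dv|(Γ) / ‖v‖_{L¹(Γ)}` over nonzero `v ∈ BV(Γ)` vanishing
on `D`. -/
def cheegerValue [Fintype E] (Γ : MetricGraph V E) (D : Set V) : ℝ :=
  sInf {r : ℝ | ∃ (v : E → ℝ → ℝ) (c : V → ℝ), Γ.IsAdmissibleBV D v c ∧
    r = (Γ.totalVariation v c).toReal / Γ.normL1 v}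

/-- The element `v` of `L¹(Γ)` is a minimizer for `Λ₁(Γ, D)` (for a suitable choice of its values
at the vertices, which are not determined by its class in `L¹(Γ)`). -/
def IsMinimizerBV [Fintype E] (Γ : MetricGraph V E) (D : Set V) (v : E → ℝ → ℝ) : Prop :=
  ∃ c : V → ℝ, Γ.IsAdmissibleBV D v c ∧
    (Γ.totalVariation v c).toReal / Γ.normL1 v = Γ.cheegerValue D

end MetricGraph

end

/-! The limit is squeezed between two comparisons of the `p`-quotient with the `1`-quotient.

Lower bound. A function vanishing on `D` satisfies `‖u‖_∞ ≤ N ‖u'‖₁`: walk along edges from a point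
of `D`. Jensen's inequality bounds `∫ |u'|^p` below by `L (‖u'‖₁ / L)^p`, with `L` the total length,
and `|u|^p ≤ ‖u‖_∞^(p-1) |u|` bounds the denominator above. Powers of `‖u'‖₁` cancel, so the
`1`-quotient is at most `K^(p-1)` times the `p`-quotient, with `K = N L` independent of `p` and `u`
(`exists_quotient_bound`). A `W^{1,p}` function is a BV competitor without jumps, hence `Λ₁ ≤
K^(p-1) λ_p`, and `K^(p-1) → 1`.

Upper bound. A BV competitor, extended by its vertex values beyond each edge, is mollified. This
does not increase the variation, and the result is exactly constant slightly beyond the ends. An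
affine rescaling brings these constants back to the vertices, so the smooth pieces fit together and
vanish on `D`, while the `L¹` norm drops by an arbitrarily small amount (`exists_contDiff_approx`).
For a fixed smooth function the `p`-quotient tends to the `1`-quotient (`tendsto_powIntegral`).

Minimizers. By the quotient bound, `‖u_p'‖₁ ≤ K^(p-1) λ_p` stays bounded as `p → 1`, which gives
`L¹` compactness (`exists_subseq_tendsto_normL1`). Variation is a supremum of functionals continuous
under `L¹` convergence together with convergence of vertex values
(`lineVariation_edgeExtension_le_of_tendsto`), so an `L¹` limit has variation at most `Λ₁` and norm
`1`. Its vertex values are subsequential limits of those of `u_p`. -/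

/-! ### Weak derivatives and primitives on an interval -/

lemma setIntegral_Ioo_eq_intervalIntegral {l : ℝ} (hl : 0 ≤ l) (f : ℝ → ℝ) :
    ∫ x in Ioo 0 l, f x = ∫ x in (0 : ℝ)..l, f x := by
  rw [intervalIntegral.integral_of_le hl, integral_Ioc_eq_integral_Ioo]

lemma intervalIntegrable_iff_integrable_restrict_Ioo {l : ℝ} (hl : 0 ≤ l) {f : ℝ → ℝ} :
    IntervalIntegrable f volume 0 l ↔ Integrable f (volume.restrict (Ioo 0 l)) := by
  rw [intervalIntegrable_iff_integrableOn_Ioo_of_le hl]; rfl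

/-- Integration by parts for a primitive of an integrable function. -/
lemma integral_primitive_mul_deriv {l : ℝ} {g φ : ℝ → ℝ}
    (hg : IntervalIntegrable g volume 0 l) (hφ : ContDiff ℝ 1 φ) :
    ∫ x in (0 : ℝ)..l, (∫ t in (0 : ℝ)..x, g t) * deriv φ x =
      (∫ t in (0 : ℝ)..l, g t) * φ l - ∫ x in (0 : ℝ)..l, g x * φ x := by
  have h1 := hg.absolutelyContinuousOnInterval_intervalIntegral (c := 0) (by simp)
  have h2 : AbsolutelyContinuousOnInterval φ 0 l :=
    hφ.contDiffOn.absolutelyContinuousOnInterval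
  rw [h1.integral_mul_deriv_eq_deriv_mul h2]
  simp only [intervalIntegral.integral_same, zero_mul, sub_zero]
  congr 1
  apply intervalIntegral.integral_congr_ae
  filter_upwards [hg.ae_hasDerivAt_integral] with x hx hx'
  rw [(hx (uIoc_subset_uIcc hx') 0 (by simp)).deriv]

/-- **Du Bois-Reymond lemma**: a function with vanishing weak derivative is constant. -/
lemma ae_eq_const_of_isWeakDeriv_zero {l : ℝ} (hl : 0 < l) {f : ℝ → ℝ}
    (hf : Integrable f (volume.restrict (Ioo 0 l))) (h : IsWeakDeriv l f 0) :
    ∃ k : ℝ, ∀ᵐ x ∂(volume.restrict (Ioo 0 l)), f x = k := by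
  let η : ContDiffBump (l / 2) := ⟨l / 8, l / 4, by linarith, by linarith⟩
  set ρ : ℝ → ℝ := η.normed volume with hρ
  have hρ1 : ContDiff ℝ ∞ ρ := η.contDiff_normed
  have hρc : HasCompactSupport ρ := η.hasCompactSupport_normed
  have hρs : tsupport ρ ⊆ Icc (l / 4) (3 * l / 4) := by
    rw [hρ, η.tsupport_normed_eq, Real.closedBall_eq_Icc]
    apply Icc_subset_Icc <;> simp only [η] <;> linarith
  have hρi : ∫ x, ρ x = 1 := η.integral_normed
  -- Testing a constant against the normalized bump `ρ` returns it, so this is the only candidate.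
  set k := ∫ x in Ioo 0 l, f x * ρ x with hk
  refine ⟨k, ?_⟩
  have hmul : ∀ ψ : ℝ → ℝ, Continuous ψ → HasCompactSupport ψ →
      Integrable (fun x => f x * ψ x) (volume.restrict (Ioo 0 l)) := by
    intro ψ h1 h2
    obtain ⟨C, hC⟩ := h2.exists_bound_of_continuous h1
    exact hf.mul_bdd h1.aestronglyMeasurable (Eventually.of_forall hC)
  have key : ∀ᵐ x, x ∈ Ioo 0 l → f x - k = 0 := by
    apply isOpen_Ioo.ae_eq_zero_of_integral_contDiff_smul_eq_zero
    · apply IntegrableOn.locallyIntegrableOn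
      exact hf.sub (integrable_const k)
    intro ψ hψ hψc hψs
    obtain ⟨a, b, ha, hb, hab⟩ : ∃ a b, 0 < a ∧ b < l ∧ tsupport ψ ⊆ Icc a b := by
      rcases (tsupport ψ).eq_empty_or_nonempty with he | hne
      · exact ⟨1, l - 1, one_pos, by linarith, by simp [he]⟩
      · have hc : IsCompact (tsupport ψ) := hψc
        exact ⟨sInf (tsupport ψ), sSup (tsupport ψ), (hψs (hc.sInf_mem hne)).1,
          (hψs (hc.sSup_mem hne)).2, fun x hx =>
            ⟨csInf_le hc.bddBelow hx, le_csSup hc.bddAbove hx⟩⟩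
    set m := ∫ x, ψ x with hm
    -- Subtracting `m * ρ` makes the integral zero, so the primitive `Φ` of `χ` is again compactly
    -- supported in `(0, l)` and can be used as a test function.
    set χ : ℝ → ℝ := fun x => ψ x - m * ρ x with hχ
    have hχ1 : ContDiff ℝ ∞ χ := hψ.sub (contDiff_const.mul hρ1)
    set a' := min a (l / 4)
    set b' := max b (3 * l / 4)
    have ha' : 0 < a' := lt_min ha (by linarith)
    have hb' : b' < l := max_lt hb (by linarith)
    have hab' : a' ≤ b' := (min_le_right _ _).trans ((by linarith : l / 4 ≤ 3 * l / 4).trans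
      (le_max_right _ _))
    have hχ0 : ∀ x, x ∉ Icc a' b' → χ x = 0 := by
      intro x hx
      have h1 : ψ x = 0 := by
        apply image_eq_zero_of_notMem_tsupport
        exact fun hx' => hx ⟨(min_le_left _ _).trans (hab hx').1, (hab hx').2.trans (le_max_left _ _)⟩
      have h2 : ρ x = 0 := by
        apply image_eq_zero_of_notMem_tsupport
        exact fun hx' => hx ⟨(min_le_right _ _).trans (hρs hx').1,
          (hρs hx').2.trans (le_max_right _ _)⟩
      simp [hχ, h1, h2]
    have hχi : ∫ x in a'..b', χ x = 0 := by
      rw [intervalIntegral.integral_of_le hab', ← integral_Icc_eq_integral_Ioc,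
        setIntegral_eq_integral_of_forall_compl_eq_zero hχ0]
      simp only [hχ]
      rw [integral_sub (hψ.continuous.integrable_of_hasCompactSupport hψc)
        ((hρ1.continuous.integrable_of_hasCompactSupport hρc).const_mul m),
        integral_const_mul, hρi]
      ring
    have hχint : ∀ c d : ℝ, IntervalIntegrable χ volume c d :=
      fun c d => hχ1.continuous.intervalIntegrable _ _
    set Φ : ℝ → ℝ := fun x => ∫ t in a'..x, χ t with hΦ
    have hΦd : ∀ x, HasDerivAt Φ (χ x) x := fun x =>
      intervalIntegral.integral_hasDerivAt_right (hχint _ _)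
        hχ1.continuous.stronglyMeasurable.stronglyMeasurableAtFilter hχ1.continuous.continuousAt
    have hΦderiv : deriv Φ = χ := funext fun x => (hΦd x).deriv
    have hΦ1 : ContDiff ℝ ∞ Φ := by
      rw [contDiff_infty_iff_deriv]
      exact ⟨fun x => (hΦd x).differentiableAt, hΦderiv ▸ hχ1⟩
    have hΦ0 : ∀ x, x ∉ Icc a' b' → Φ x = 0 := by
      intro x hx
      have hz : ∀ c d : ℝ, (∀ t ∈ uIoo c d, t ∉ Icc a' b') → ∫ t in c..d, χ t = 0 := by
        intro c d hcd
        rw [intervalIntegral.integral_congr_uIoo (g := fun _ => 0) (fun t ht => hχ0 t (hcd t ht))]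
        simp
      by_cases hxa : x < a'
      · apply hz
        intro t ht ht'
        rw [uIoo_of_ge hxa.le] at ht
        exact absurd ht.2 (not_lt.2 ht'.1)
      · have hxb : b' < x := by
          by_contra hxb
          exact hx ⟨not_lt.1 hxa, not_lt.1 hxb⟩
        rw [hΦ]
        simp only
        rw [← intervalIntegral.integral_add_adjacent_intervals (hχint a' b') (hχint b' x), hχi,
          hz b' x, add_zero]
        intro t ht ht'
        rw [uIoo_of_le hxb.le] at ht
        exact absurd ht.1 (not_lt.2 ht'.2)
    have hΦc : HasCompactSupport Φ := HasCompactSupport.intro isCompact_Icc hΦ0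
    have hΦs : tsupport Φ ⊆ Ioo 0 l := by
      refine (closure_minimal (t := Icc a' b') ?_ isClosed_Icc).trans
        (fun x hx => ⟨ha'.trans_le hx.1, hx.2.trans_lt hb'⟩)
      intro x hx
      by_contra h'
      exact hx (hΦ0 x h')
    have := h Φ hΦ1 hΦc hΦs
    rw [hΦderiv] at this
    simp only [Pi.zero_apply, zero_mul, integral_zero, neg_zero] at this
    have hψI : ∫ x in Ioo 0 l, ψ x = m := by
      apply setIntegral_eq_integral_of_forall_compl_eq_zero
      intro x hx
      exact image_eq_zero_of_notMem_tsupport fun hx' => hx (hψs hx')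
    have e1 : ∫ x in Ioo 0 l, f x * χ x = (∫ x in Ioo 0 l, f x * ψ x) - m * k := by
      simp only [hχ, mul_sub]
      rw [integral_sub (hmul ψ hψ.continuous hψc), hk, ← integral_const_mul]
      · congr 2; ext x; ring
      · have := (hmul ρ hρ1.continuous hρc).const_mul m
        refine this.congr (Eventually.of_forall fun x => ?_)
        simp only; ring
    have e2 : ∫ x, ψ x • (f x - k) = ∫ x in Ioo 0 l, (f x * ψ x - k * ψ x) := by
      rw [← setIntegral_eq_integral_of_forall_compl_eq_zero (s := Ioo 0 l)]
      · congr 1; ext x; simp only [smul_eq_mul]; ring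
      · intro x hx
        rw [image_eq_zero_of_notMem_tsupport fun hx' => hx (hψs hx'), zero_smul]
    rw [e2, integral_sub (hmul ψ hψ.continuous hψc)
      ((hψ.continuous.integrable_of_hasCompactSupport hψc).restrict.const_mul k),
      integral_const_mul, hψI]
    linarith
  rw [ae_restrict_iff' measurableSet_Ioo]
  filter_upwards [key] with x hx hx'
  linarith [hx hx']

/-- A continuous function with integrable weak derivative is a primitive of the latter. -/
lemma IsWeakDeriv.eq_add_integral {l : ℝ} (hl : 0 < l) {u g : ℝ → ℝ}
    (hu : ContinuousOn u (Icc 0 l)) (hg : Integrable g (volume.restrict (Ioo 0 l)))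
    (h : IsWeakDeriv l u g) {x : ℝ} (hx : x ∈ Icc 0 l) :
    u x = u 0 + ∫ t in (0 : ℝ)..x, g t := by
  have hg' := (intervalIntegrable_iff_integrable_restrict_Ioo hl.le).2 hg
  set G : ℝ → ℝ := fun x => ∫ t in (0 : ℝ)..x, g t
  have hG : ContinuousOn G (Icc 0 l) := by
    have := (hg'.absolutelyContinuousOnInterval_intervalIntegral (c := 0) (by simp)).continuousOn
    rwa [uIcc_of_le hl.le] at this
  have hint : ∀ {w : ℝ → ℝ}, ContinuousOn w (Icc 0 l) →
      Integrable w (volume.restrict (Ioo 0 l)) := fun hw =>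
    (hw.integrableOn_Icc).mono_set Ioo_subset_Icc_self
  have hmul : ∀ {w ψ : ℝ → ℝ}, ContinuousOn w (Icc 0 l) → Continuous ψ →
      Integrable (fun x => w x * ψ x) (volume.restrict (Ioo 0 l)) := fun hw hψ =>
    hint (hw.mul hψ.continuousOn)
  obtain ⟨k, hk⟩ := ae_eq_const_of_isWeakDeriv_zero hl (f := fun x => u x - G x)
    (hint (hu.sub hG)) (by
      intro φ hφ hφc hφs
      have hφ' : Continuous (deriv φ) := hφ.continuous_deriv (by simp)
      have h0 : φ l = 0 := image_eq_zero_of_notMem_tsupport fun hx' => lt_irrefl _ (hφs hx').2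
      simp only [sub_mul, Pi.zero_apply, zero_mul, integral_zero, neg_zero]
      rw [integral_sub (hmul hu hφ') (hmul hG hφ'), h φ hφ hφc hφs,
        setIntegral_Ioo_eq_intervalIntegral hl.le (fun x => G x * deriv φ x),
        integral_primitive_mul_deriv hg' (hφ.of_le (by norm_cast)), h0,
        setIntegral_Ioo_eq_intervalIntegral hl.le]
      ring)
  -- Continuity upgrades equality almost everywhere to the open interval, and then to its closure;
  -- evaluating at `0` identifies `k`.
  have heq : EqOn (fun x => u x - G x) (fun _ => k) (Ioo 0 l) :=
    Measure.eqOn_open_of_ae_eq hk isOpen_Ioo ((hu.sub hG).mono Ioo_subset_Icc_self)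
      continuousOn_const
  have heq' : EqOn (fun x => u x - G x) (fun _ => k) (Icc 0 l) := by
    rw [← closure_Ioo hl.ne]
    refine heq.of_subset_closure ?_ continuousOn_const subset_closure subset_rfl
    rw [closure_Ioo hl.ne]
    exact hu.sub hG
  have h0 := heq' (left_mem_Icc.2 hl.le)
  have h1 := heq' hx
  simp only [G, intervalIntegral.integral_same] at h0 h1
  linarith

/-! ### Variation of functions extended by constants -/

/-- The function equal to `v` on `(0, l)`, to `a` on the left and to `b` on the right of this
interval. -/
noncomputable def extendByConst (l a b : ℝ) (v : ℝ → ℝ) : ℝ → ℝ :=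
  fun x => if x ≤ 0 then a else if x < l then v x else b

lemma extendByConst_eq_indicator {l : ℝ} (hl : 0 < l) (a b : ℝ) (v : ℝ → ℝ) :
    extendByConst l a b v = fun x => (Iic 0).indicator (fun _ => a) x +
      (Ioo 0 l).indicator v x + (Ici l).indicator (fun _ => b) x := by
  ext x
  simp only [extendByConst, indicator, mem_Iic, mem_Ioo, mem_Ici]
  grind

lemma locallyIntegrable_extendByConst {l : ℝ} (hl : 0 < l) (a b : ℝ) {v : ℝ → ℝ}
    (hv : Integrable v (volume.restrict (Ioo 0 l))) :
    LocallyIntegrable (extendByConst l a b v) := by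
  rw [extendByConst_eq_indicator hl]
  have h2 : LocallyIntegrable ((Ioo 0 l).indicator v) :=
    ((integrable_indicator_iff measurableSet_Ioo).2 hv).locallyIntegrable
  exact (((locallyIntegrable_const a).indicator measurableSet_Iic).add h2).add
    ((locallyIntegrable_const b).indicator measurableSet_Ici)

/-- On the two rays `deriv φ` integrates to `φ 0` and `-φ l`. The vertex values thus enter the
variation only through two point evaluations of `φ`, which makes passing to the limit in them
immediate. -/
lemma integral_extendByConst_mul_deriv {l : ℝ} (hl : 0 < l) (a b : ℝ) {v φ : ℝ → ℝ}
    (hv : Integrable v (volume.restrict (Ioo 0 l))) (hφ : ContDiff ℝ 1 φ)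
    (hφc : HasCompactSupport φ) :
    ∫ x, extendByConst l a b v x * deriv φ x =
      a * φ 0 + (∫ x in Ioo 0 l, v x * deriv φ x) - b * φ l := by
  have hφ' : Continuous (deriv φ) := hφ.continuous_deriv le_rfl
  have hi : Integrable (deriv φ) := hφ'.integrable_of_hasCompactSupport hφc.deriv
  obtain ⟨C, hC⟩ := hφc.deriv.exists_bound_of_continuous hφ'
  have h2 : Integrable (fun x => v x * deriv φ x) (volume.restrict (Ioo 0 l)) :=
    hv.mul_bdd hφ'.aestronglyMeasurable (Eventually.of_forall hC)
  have e : (fun x => extendByConst l a b v x * deriv φ x) = fun x =>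
      (Iic 0).indicator (fun x => a * deriv φ x) x +
      (Ioo 0 l).indicator (fun x => v x * deriv φ x) x +
      (Ici l).indicator (fun x => b * deriv φ x) x := by
    rw [extendByConst_eq_indicator hl]
    ext x
    simp only [indicator]
    split_ifs <;> ring
  have i1 : Integrable ((Iic (0 : ℝ)).indicator (fun x => a * deriv φ x)) :=
    (hi.const_mul a).indicator measurableSet_Iic
  have i2 : Integrable ((Ioo 0 l).indicator (fun x => v x * deriv φ x)) :=
    (integrable_indicator_iff measurableSet_Ioo).2 h2
  have i3 : Integrable ((Ici l).indicator (fun x => b * deriv φ x)) :=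
    (hi.const_mul b).indicator measurableSet_Ici
  have i12 : Integrable (fun x => (Iic (0 : ℝ)).indicator (fun x => a * deriv φ x) x +
      (Ioo 0 l).indicator (fun x => v x * deriv φ x) x) := i1.add i2
  rw [e, integral_add i12 i3, integral_add i1 i2, integral_indicator measurableSet_Iic,
    integral_indicator measurableSet_Ioo, integral_indicator measurableSet_Ici,
    integral_const_mul, integral_const_mul, hφc.integral_Iic_deriv_eq hφ,
    integral_Ici_eq_integral_Ioi, hφc.integral_Ioi_deriv_eq hφ]
  ring

/-- The variation of an absolutely continuous function is at most the integral of the modulus of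
its derivative. -/
lemma lineVariation_extendByConst_le {l : ℝ} (hl : 0 < l) {u g : ℝ → ℝ}
    (hu : ContinuousOn u (Icc 0 l)) (hg : Integrable g (volume.restrict (Ioo 0 l)))
    (h : ∀ x ∈ Icc 0 l, u x = u 0 + ∫ t in (0 : ℝ)..x, g t) :
    lineVariation (extendByConst l (u 0) (u l) u) ≤ ENNReal.ofReal (∫ x in Ioo 0 l, |g x|) := by
  refine iSup₂_le fun φ hφ => ENNReal.ofReal_le_ofReal ?_
  obtain ⟨hφ, hφc, hφ1⟩ := hφ
  have hg' := (intervalIntegrable_iff_integrable_restrict_Ioo hl.le).2 hg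
  have hφ' : Continuous (deriv φ) := hφ.continuous_deriv le_rfl
  rw [integral_extendByConst_mul_deriv hl _ _ ((hu.integrableOn_Icc).mono_set Ioo_subset_Icc_self)
    hφ hφc]
  have hgφ : Integrable (fun x => g x * φ x) (volume.restrict (Ioo 0 l)) :=
    hg.mul_bdd hφ.continuous.aestronglyMeasurable (c := 1) (Eventually.of_forall hφ1)
  have hG : ContinuousOn (fun x => ∫ t in (0 : ℝ)..x, g t) (Icc 0 l) := by
    have := (hg'.absolutelyContinuousOnInterval_intervalIntegral (c := 0) (by simp)).continuousOn
    rwa [uIcc_of_le hl.le] at this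
  have e1 : ∫ x in Ioo 0 l, u x * deriv φ x =
      u 0 * (φ l - φ 0) + ((∫ t in (0 : ℝ)..l, g t) * φ l - ∫ x in Ioo 0 l, g x * φ x) := by
    rw [setIntegral_congr_fun (g := fun x => u 0 * deriv φ x +
      (∫ t in (0 : ℝ)..x, g t) * deriv φ x) measurableSet_Ioo (fun x hx => by
        simp only [h x (Ioo_subset_Icc_self hx)]; ring)]
    rw [integral_add, integral_const_mul, setIntegral_Ioo_eq_intervalIntegral hl.le (deriv φ),
      intervalIntegral.integral_deriv_eq_sub
        (fun x _ => (hφ.differentiable one_ne_zero).differentiableAt)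
        (hφ'.intervalIntegrable _ _),
      setIntegral_Ioo_eq_intervalIntegral hl.le
        (fun x => (∫ t in (0 : ℝ)..x, g t) * deriv φ x),
      integral_primitive_mul_deriv hg' hφ, setIntegral_Ioo_eq_intervalIntegral hl.le]
    · exact ((continuous_const.mul hφ').continuousOn.integrableOn_Icc).mono_set
        Ioo_subset_Icc_self
    · exact ((hG.mul hφ'.continuousOn).integrableOn_Icc).mono_set Ioo_subset_Icc_self
  -- All boundary terms cancel because the extension has no jumps at `0` and `l`.
  rw [e1, h l (right_mem_Icc.2 hl.le)]
  calc _ = ∫ x in Ioo 0 l, -(g x * φ x) := by rw [integral_neg]; ring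
    _ ≤ _ := by
      refine integral_mono hgφ.neg hg.abs fun x => ?_
      have h1 := neg_le_abs (g x * φ x)
      rw [abs_mul] at h1
      exact h1.trans (mul_le_of_le_one_right (abs_nonneg _) (hφ1 x))

/-! ### Smooth approximation with fixed end values -/

/-- The variation of a smooth function is the integral of the modulus of its derivative. -/
lemma integral_abs_deriv_le_lineVariation {F : ℝ → ℝ} (hF : ContDiff ℝ ∞ F)
    (hFc : HasCompactSupport (deriv F)) (hV : lineVariation F ≠ ⊤) :
    ∫ x, |deriv F x| ≤ (lineVariation F).toReal := by
  have hF' : ContDiff ℝ ∞ (deriv F) := (contDiff_infty_iff_deriv.1 hF).2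
  set g := deriv F with hg
  set M := (volume (tsupport g)).toReal
  have hK : volume (tsupport g) ≠ ⊤ := hFc.isCompact.measure_lt_top.ne
  have key : ∀ δ : ℝ, 0 < δ → ∫ x, |g x| ≤ (lineVariation F).toReal + δ * M := by
    intro δ hδ
    have hpos : ∀ x, 0 < g x ^ 2 + δ ^ 2 := fun x => by positivity
    -- A smooth substitute for `-sign g`; the minus sign compensates for the one produced by
    -- integration by parts.
    set φ : ℝ → ℝ := fun x => -(g x / √(g x ^ 2 + δ ^ 2)) with hφ
    have hφ1 : ContDiff ℝ ∞ φ :=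
      (hF'.div (((hF'.pow 2).add contDiff_const).sqrt fun x => (hpos x).ne')
        fun x => (Real.sqrt_pos.2 (hpos x)).ne').neg
    have hφ1' : ContDiff ℝ 1 φ := hφ1.of_le (by norm_cast)
    have hφ0 : ∀ x, g x = 0 → φ x = 0 := fun x hx => by simp [hφ, hx]
    have hφc : HasCompactSupport φ :=
      hFc.mono' fun x hx => subset_tsupport _ fun h => hx (hφ0 x h)
    have hφb : ∀ x, |φ x| ≤ 1 := fun x => by
      rw [hφ]
      simp only [abs_neg, abs_div, abs_of_pos (Real.sqrt_pos.2 (hpos x))]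
      rw [div_le_one (Real.sqrt_pos.2 (hpos x))]
      apply Real.le_sqrt_of_sq_le
      rw [sq_abs]; nlinarith
    have hle : ENNReal.ofReal (∫ x, F x * deriv φ x) ≤ lineVariation F :=
      le_iSup₂_of_le φ ⟨hφ1', hφc, hφb⟩ le_rfl
    have hle' := (ENNReal.ofReal_le_iff_le_toReal hV).1 hle
    have hφ'c : Continuous (deriv φ) := hφ1'.continuous_deriv le_rfl
    have hgφ : Integrable (fun x => g x * φ x) :=
      (hF'.continuous.mul hφ1.continuous).integrable_of_hasCompactSupport hφc.mul_left
    have hparts : ∫ x, F x * deriv φ x = - ∫ x, g x * φ x := by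
      apply integral_mul_deriv_eq_deriv_mul_of_integrable
      · exact fun x _ => (hF.differentiable (by simp) x).hasDerivAt
      · exact fun x _ => (hφ1.differentiable (by simp) x).hasDerivAt
      · exact (hF.continuous.mul hφ'c).integrable_of_hasCompactSupport hφc.deriv.mul_left
      · exact hgφ
      · exact (hF.continuous.mul hφ1.continuous).integrable_of_hasCompactSupport hφc.mul_left
    have hgφn : Integrable (fun x => -(g x * φ x)) := hgφ.neg
    have hind : Integrable ((tsupport g).indicator fun _ => δ) :=
      (integrable_indicator_iff (isClosed_tsupport g).measurableSet).2
        (integrableOn_const hK)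
    -- Regularizing the sign costs at most `δ` at each point of the support, since `(|g| - δ) (|g| +
    -- δ) ≤ g²`, and nothing elsewhere.
    have hpt : ∀ x, |g x| ≤ -(g x * φ x) + (tsupport g).indicator (fun _ => δ) x := by
      intro x
      by_cases hx : x ∈ tsupport g
      · rw [indicator_of_mem hx, hφ]
        have hs := Real.sqrt_pos.2 (hpos x)
        have hs2 : √(g x ^ 2 + δ ^ 2) ^ 2 = g x ^ 2 + δ ^ 2 := Real.sq_sqrt (hpos x).le
        have : -(g x * -(g x / √(g x ^ 2 + δ ^ 2))) = g x ^ 2 / √(g x ^ 2 + δ ^ 2) := by ring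
        simp only
        rw [this, ← sub_le_iff_le_add, le_div_iff₀ hs]
        have h3 : √(g x ^ 2 + δ ^ 2) ≤ |g x| + δ := by
          apply Real.sqrt_le_iff.2 ⟨by positivity, _⟩
          nlinarith [sq_abs (g x), abs_nonneg (g x)]
        rcases le_total (|g x|) δ with h4 | h4
        · nlinarith [sq_nonneg (g x)]
        · nlinarith [sq_abs (g x), abs_nonneg (g x)]
      · rw [image_eq_zero_of_notMem_tsupport hx]
        simp [indicator_of_notMem hx]
    calc ∫ x, |g x| ≤ ∫ x, (-(g x * φ x) + (tsupport g).indicator (fun _ => δ) x) :=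
          integral_mono (hF'.continuous.integrable_of_hasCompactSupport hFc).abs
            (hgφn.add hind) hpt
      _ = (- ∫ x, g x * φ x) + M * δ := by
          rw [integral_add hgφn hind, integral_neg,
            integral_indicator (isClosed_tsupport g).measurableSet, setIntegral_const,
            smul_eq_mul]
          rfl
      _ ≤ _ := by rw [← hparts, mul_comm]; linarith
  have hM : 0 ≤ M := ENNReal.toReal_nonneg
  refine le_of_forall_pos_le_add fun ε hε => (key (ε / (M + 1)) (by positivity)).trans ?_
  gcongr
  rw [div_mul_eq_mul_div, div_le_iff₀ (by positivity)]
  nlinarith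

/-- Mollification does not increase the variation. -/
lemma lineVariation_convolution_le {f ρ : ℝ → ℝ} (hf : LocallyIntegrable f)
    (hρ : Continuous ρ) (hρc : HasCompactSupport ρ) (hρ0 : ∀ x, 0 ≤ ρ x) (hρ1 : ∫ x, ρ x = 1) :
    lineVariation (convolution ρ f (ContinuousLinearMap.lsmul ℝ ℝ) volume) ≤ lineVariation f := by
  by_cases hV : lineVariation f = ⊤
  · rw [hV]; exact le_top
  refine iSup₂_le fun φ hφ => ?_
  obtain ⟨hφ, hφc, hφ1⟩ := hφ
  rw [ENNReal.ofReal_le_iff_le_toReal hV]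
  have hφ' : Continuous (deriv φ) := hφ.continuous_deriv le_rfl
  -- Translates of test functions are test functions, so every translate of `f` obeys the same
  -- bound; the mollification is an average of translates.
  have hshift : ∀ z, ∫ x, f (x - z) * deriv φ x ≤ (lineVariation f).toReal := by
    intro z
    rw [← ENNReal.ofReal_le_iff_le_toReal hV]
    refine le_iSup₂_of_le (fun y => φ (y + z)) ⟨hφ.comp (contDiff_id.add contDiff_const),
      hφc.comp_homeomorph (Homeomorph.addRight z), fun x => hφ1 _⟩ (ENNReal.ofReal_le_ofReal ?_)
    rw [← integral_add_right_eq_self (fun x => f (x - z) * deriv φ x) z]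
    refine le_of_eq (integral_congr_ae (Eventually.of_forall fun y => ?_))
    simp only [add_sub_cancel_right, deriv_comp_add_const]
  -- Only values of `f` on this compact set matter. Truncating `f` to it gives the global
  -- integrability needed for Fubini.
  set K : Set ℝ := (fun p : ℝ × ℝ => p.1 - p.2) '' (tsupport (deriv φ) ×ˢ tsupport ρ)
  have hK : IsCompact K := (hφc.deriv.isCompact.prod hρc.isCompact).image (by fun_prop)
  have hfK : Integrable (K.indicator f) :=
    (integrable_indicator_iff hK.measurableSet).2 (hf.integrableOn_isCompact hK)
  obtain ⟨C, hC⟩ := hφc.deriv.exists_bound_of_continuous hφ'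
  have hint : Integrable (fun p : ℝ × ℝ => ρ p.2 * f (p.1 - p.2) * deriv φ p.1)
      (volume.prod volume) := by
    have h1 := (hρ.integrable_of_hasCompactSupport hρc (μ := volume)).convolution_integrand
      (ContinuousLinearMap.lsmul ℝ ℝ) hfK
    have h2 := h1.mul_bdd (g := fun p : ℝ × ℝ => deriv φ p.1) (c := C)
      (hφ'.comp continuous_fst).aestronglyMeasurable (Eventually.of_forall fun p => hC p.1)
    refine h2.congr (Eventually.of_forall fun p => ?_)
    simp only [ContinuousLinearMap.lsmul_apply, smul_eq_mul]
    by_cases hp1 : p.1 ∈ tsupport (deriv φ)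
    · by_cases hp2 : p.2 ∈ tsupport ρ
      · rw [indicator_of_mem]
        exact ⟨p, ⟨hp1, hp2⟩, rfl⟩
      · rw [image_eq_zero_of_notMem_tsupport hp2]; simp
    · rw [image_eq_zero_of_notMem_tsupport hp1]; simp
  calc ∫ x, convolution ρ f (ContinuousLinearMap.lsmul ℝ ℝ) volume x * deriv φ x
      = ∫ x, ∫ z, ρ z * f (x - z) * deriv φ x := by
        congr 1; ext x
        rw [integral_mul_const]; rfl
    _ = ∫ z, ∫ x, ρ z * f (x - z) * deriv φ x := integral_integral_swap hint
    _ = ∫ z, ρ z * ∫ x, f (x - z) * deriv φ x := by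
        congr 1; ext z
        rw [← integral_const_mul]; congr 1; ext x; ring
    _ ≤ ∫ z, ρ z * (lineVariation f).toReal := by
        apply integral_mono
        · refine hint.integral_prod_right.congr (Eventually.of_forall fun z => ?_)
          simp only
          rw [← integral_const_mul]; congr 1; ext x; ring
        · exact (hρ.integrable_of_hasCompactSupport hρc).mul_const _
        · exact fun z => mul_le_mul_of_nonneg_left (hshift z) (hρ0 z)
    _ = (lineVariation f).toReal := by rw [integral_mul_const, hρ1, one_mul]

/-- A function of bounded variation on a closed interval, with prescribed values at the ends, is
approximated by smooth functions with the same values at the ends and no larger variation, whose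
`L¹` norm is almost as large. -/
lemma exists_contDiff_approx {l a b : ℝ} (hl : 0 < l) {v : ℝ → ℝ}
    (hv : Integrable v (volume.restrict (Ioo 0 l)))
    (hV : lineVariation (extendByConst l a b v) ≠ ⊤) {ε : ℝ} (hε : 0 < ε) :
    ∃ G : ℝ → ℝ, ContDiff ℝ ∞ G ∧ G 0 = a ∧ G l = b ∧
      ∫ x in Ioo 0 l, |deriv G x| ≤ (lineVariation (extendByConst l a b v)).toReal ∧
      (∫ x in Ioo 0 l, |v x|) - ε ≤ ∫ x in Ioo 0 l, |G x| := by
  set f := extendByConst l a b v with hf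
  have hfl : LocallyIntegrable f := locallyIntegrable_extendByConst hl a b hv
  set r : ℕ → ℝ := fun n => 1 / ((n : ℝ) + 1) with hr
  have hr0 : ∀ n, 0 < r n := fun n => by positivity
  have hrt : Tendsto r atTop (𝓝 0) := tendsto_one_div_add_atTop_nhds_zero_nat
  let φ : ℕ → ContDiffBump (0 : ℝ) := fun n =>
    ⟨r n / 2, r n, half_pos (hr0 n), half_lt_self (hr0 n)⟩
  have hφr : ∀ n, (φ n).rOut = r n := fun n => rfl
  set F : ℕ → ℝ → ℝ := fun n =>
    convolution ((φ n).normed volume) f (ContinuousLinearMap.lsmul ℝ ℝ) volume with hF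
  have hFs : ∀ n, ContDiff ℝ ∞ (F n) := fun n =>
    (φ n).hasCompactSupport_normed.contDiff_convolution_left _ (φ n).contDiff_normed hfl
  have hFae : ∀ᵐ x, Tendsto (fun n => F n x) atTop (𝓝 (f x)) :=
    ContDiffBump.ae_convolution_tendsto_right_of_locallyIntegrable (K := 2)
      (by simpa only [hφr] using hrt)
      (Eventually.of_forall fun n => by simp only [φ]; linarith) hfl
  have hFV : ∀ n, lineVariation (F n) ≤ lineVariation f := fun n =>
    lineVariation_convolution_le hfl (φ n).continuous_normed (φ n).hasCompactSupport_normed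
      (φ n).nonneg_normed (φ n).integral_normed
  have hFa : ∀ n x, x ≤ -r n → F n x = a := by
    intro n x hx
    have hfx : ∀ y ≤ 0, f y = a := fun y hy => by simp [hf, extendByConst, hy]
    have hx0 : x ≤ 0 := hx.trans (neg_nonpos.2 (hr0 n).le)
    rw [← hfx x hx0]
    apply ContDiffBump.normed_convolution_eq_right
    intro y hy
    rw [hφr, Real.ball_eq_Ioo] at hy
    rw [hfx x hx0, hfx y (by linarith [hy.2])]
  have hFb : ∀ n x, l + r n ≤ x → F n x = b := by
    intro n x hx
    have hfx : ∀ y, l ≤ y → f y = b := fun y hy => by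
      simp [hf, extendByConst, (hl.trans_le hy).not_ge, hy.not_gt]
    have hx0 : l ≤ x := by linarith [hr0 n]
    rw [← hfx x hx0]
    apply ContDiffBump.normed_convolution_eq_right
    intro y hy
    rw [hφr, Real.ball_eq_Ioo] at hy
    rw [hfx x hx0, hfx y (by linarith [hy.1])]
  have hF'0 : ∀ n x, x ∉ Icc (-r n) (l + r n) → deriv (F n) x = 0 := by
    intro n x hx
    rcases lt_or_ge x (-r n) with h | h
    · rw [EventuallyEq.deriv_eq (f := fun _ => a), deriv_const]
      filter_upwards [Iio_mem_nhds h] with y hy using hFa n y (le_of_lt hy)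
    · have h' : l + r n < x := by
        by_contra h'; exact hx ⟨h, not_lt.1 h'⟩
      rw [EventuallyEq.deriv_eq (f := fun _ => b), deriv_const]
      filter_upwards [Ioi_mem_nhds h'] with y hy using hFb n y (le_of_lt hy)
  have hFI : ∀ n, ∫ x, |deriv (F n) x| ≤ (lineVariation f).toReal := fun n =>
    (integral_abs_deriv_le_lineVariation (hFs n)
      (HasCompactSupport.intro isCompact_Icc (hF'0 n)) ((hFV n).trans_lt hV.lt_top).ne).trans
      (ENNReal.toReal_mono hV (hFV n))
  -- The map `x ↦ s n * x - r n` carries `[0, l]` onto `[-r n, l + r n]`, at whose ends `F n` equals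
  -- exactly `a` and `b`. The substitution preserves the integral of the modulus of the derivative
  -- and multiplies the `L¹` norm by `(s n)⁻¹ → 1`.
  set s : ℕ → ℝ := fun n => (l + 2 * r n) / l with hs
  have hs0 : ∀ n, 0 < s n := fun n => by have := hr0 n; positivity
  have hsl : ∀ n, s n * l = l + 2 * r n := fun n => by simp only [hs]; field_simp
  have hscale : ∀ n (h : ℝ → ℝ), ∫ x in Ioo 0 l, h (s n * x + -r n) =
      (s n)⁻¹ * ∫ y in (-r n)..(l + r n), h y := by
    intro n h
    rw [setIntegral_Ioo_eq_intervalIntegral hl.le,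
      intervalIntegral.integral_comp_mul_add h (hs0 n).ne', smul_eq_mul, mul_zero, zero_add, hsl]
    congr 2; ring
  have hle : ∀ n, -r n ≤ l + r n := fun n => by linarith [hr0 n]
  set A := ∫ x in Ioo 0 l, |v x| with hA
  have hfv : ∀ x ∈ Ioo 0 l, f x = v x := fun x hx => by
    simp [hf, extendByConst, hx.1.not_ge, hx.2]
  have hFint : ∀ n, Integrable (F n) (volume.restrict (Ioo 0 l)) := fun n =>
    ((hFs n).continuous.continuousOn.integrableOn_Icc).mono_set Ioo_subset_Icc_self
  -- Only a lower bound on the `L¹` norms is needed, so almost everywhere convergence and Fatou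
  -- suffice.
  have hfatou : ENNReal.ofReal A ≤
      liminf (fun n => ENNReal.ofReal (∫ x in Ioo 0 l, |F n x|)) atTop := by
    calc ENNReal.ofReal A = ∫⁻ x in Ioo 0 l, ENNReal.ofReal |v x| :=
          ofReal_integral_eq_lintegral_ofReal hv.abs (Eventually.of_forall fun x => abs_nonneg _)
      _ = ∫⁻ x in Ioo 0 l, liminf (fun n => ENNReal.ofReal |F n x|) atTop := by
          apply lintegral_congr_ae
          rw [EventuallyEq, ae_restrict_iff' measurableSet_Ioo]
          filter_upwards [hFae] with x hx hx'
          rw [hfv x hx'] at hx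
          exact ((ENNReal.continuous_ofReal.tendsto _).comp hx.abs).liminf_eq.symm
      _ ≤ liminf (fun n => ∫⁻ x in Ioo 0 l, ENNReal.ofReal |F n x|) atTop :=
          lintegral_liminf_le fun n =>
            ((hFs n).continuous.abs.measurable).ennreal_ofReal
      _ = _ := by
          congr 1; ext n
          exact (ofReal_integral_eq_lintegral_ofReal (hFint n).abs
            (Eventually.of_forall fun x => abs_nonneg _)).symm
  have hev : ∀ᶠ n in atTop, A - ε / 2 < ∫ x in Ioo 0 l, |F n x| := by
    -- `ENNReal.ofReal` truncates negative numbers, so this trivial case is treated separately.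
    by_cases hA0 : A - ε / 2 < 0
    · exact Eventually.of_forall fun n => hA0.trans_le (integral_nonneg fun x => abs_nonneg _)
    · have h1 : ENNReal.ofReal (A - ε / 2) < ENNReal.ofReal A :=
        (ENNReal.ofReal_lt_ofReal_iff_of_nonneg (not_lt.1 hA0)).2 (by linarith)
      filter_upwards [eventually_lt_of_lt_liminf (h1.trans_le hfatou)] with n hn
      exact (ENNReal.ofReal_lt_ofReal_iff_of_nonneg (not_lt.1 hA0)).1 hn
  have hst : Tendsto (fun n => (s n)⁻¹ * (A - ε / 2)) atTop (𝓝 (A - ε / 2)) := by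
    have h1 : Tendsto s atTop (𝓝 ((l + 2 * 0) / l)) :=
      (tendsto_const_nhds.add (hrt.const_mul 2)).div_const l
    rw [mul_zero, add_zero, div_self hl.ne'] at h1
    simpa using (h1.inv₀ one_ne_zero).mul_const (A - ε / 2)
  obtain ⟨n, hn1, hn2⟩ := (hev.and (hst.eventually (lt_mem_nhds (by linarith :
    A - ε < A - ε / 2)))).exists
  refine ⟨fun x => F n (s n * x + -r n),
    (hFs n).comp ((contDiff_const.mul contDiff_id).add contDiff_const), ?_, ?_, ?_, ?_⟩
  · exact hFa n _ (by simp)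
  · exact hFb n _ (by rw [hsl]; linarith)
  · have hd : ∀ x, deriv (fun x => F n (s n * x + -r n)) x = s n * deriv (F n) (s n * x + -r n) := by
      intro x
      have h1 : HasDerivAt (fun x => s n * x + -r n) (s n) x := by
        simpa using ((hasDerivAt_id x).const_mul (s n)).add_const (-r n)
      have h2 := (((hFs n).differentiable (by simp)) (s n * x + -r n)).hasDerivAt
      exact (h2.comp x h1).deriv.trans (mul_comm _ _)
    simp only [hd, abs_mul, abs_of_pos (hs0 n)]
    rw [integral_const_mul, hscale n (fun y => |deriv (F n) y|), mul_inv_cancel_left₀ (hs0 n).ne',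
      intervalIntegral.integral_of_le (hle n)]
    have hi : Integrable fun x => |deriv (F n) x| :=
      (((contDiff_infty_iff_deriv.1 (hFs n)).2.continuous).integrable_of_hasCompactSupport
        (HasCompactSupport.intro isCompact_Icc (hF'0 n))).abs
    exact (setIntegral_le_integral hi (Eventually.of_forall fun x => abs_nonneg _)).trans (hFI n)
  · rw [hscale n (fun y => |F n y|)]
    refine hn2.le.trans (mul_le_mul_of_nonneg_left (hn1.le.trans ?_) (inv_pos.2 (hs0 n)).le)
    rw [intervalIntegral.integral_of_le (hle n)]
    refine setIntegral_mono_set ?_ (Eventually.of_forall fun x => abs_nonneg _) ?_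
    · exact ((hFs n).continuous.abs.continuousOn.integrableOn_Icc).mono_set Ioc_subset_Icc_self
    · exact (Ioo_subset_Ioc_self.trans (Ioc_subset_Ioc (by linarith [hr0 n])
        (by linarith [hr0 n]))).eventuallyLE

/-- Convexity of the power function, obtained from Bernoulli's inequality at `s / t - 1`. Integrated
with `t` equal to the mean, it yields Jensen's inequality. -/
lemma rpow_tangent_le {p s t : ℝ} (hp : 1 ≤ p) (hs : 0 ≤ s) (ht : 0 < t) :
    t ^ p + p * t ^ (p - 1) * (s - t) ≤ s ^ p := by
  have h := one_add_mul_self_le_rpow_one_add (s := s / t - 1)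
    (by have : 0 ≤ s / t := by positivity
        linarith) hp
  rw [add_sub_cancel, Real.div_rpow hs ht.le, le_div_iff₀ (Real.rpow_pos_of_pos ht p)] at h
  refine le_trans (le_of_eq ?_) h
  rw [Real.rpow_sub_one ht.ne']
  field_simp

/-- A continuous function on a closed interval that vanishes almost everywhere vanishes. -/
lemma eqOn_zero_of_ae_eq_zero {l : ℝ} (hl : 0 < l) {u : ℝ → ℝ} (hu : ContinuousOn u (Icc 0 l))
    (h : ∀ᵐ x ∂(volume.restrict (Ioo 0 l)), u x = 0) : ∀ x ∈ Icc 0 l, u x = 0 := by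
  have heq : EqOn u (fun _ => 0) (Ioo 0 l) :=
    Measure.eqOn_open_of_ae_eq h isOpen_Ioo (hu.mono Ioo_subset_Icc_self) continuousOn_const
  rw [← closure_Ioo hl.ne] at hu ⊢
  exact heq.of_subset_closure hu continuousOn_const subset_closure subset_rfl

/-! ### Admissible functions on the graph and comparison of the quotients -/

namespace MetricGraph

variable {V E : Type*}

instance (Γ : MetricGraph V E) (e : E) : IsFiniteMeasure (Γ.edgeMeasure e) := by
  unfold edgeMeasure; infer_instance

lemma ae_edgeMeasure (Γ : MetricGraph V E) (e : E) :
    ∀ᵐ x ∂(Γ.edgeMeasure e), x ∈ Ioo 0 (Γ.len e) :=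
  ae_restrict_mem measurableSet_Ioo

lemma integrable_of_continuousOn (Γ : MetricGraph V E) {e : E} {f : ℝ → ℝ}
    (hf : ContinuousOn f (Icc 0 (Γ.len e))) : Integrable f (Γ.edgeMeasure e) :=
  hf.integrableOn_Icc.mono_set Ioo_subset_Icc_self

lemma integral_const_edgeMeasure (Γ : MetricGraph V E) (e : E) (k : ℝ) :
    ∫ _, k ∂(Γ.edgeMeasure e) = Γ.len e * k := by
  simp [edgeMeasure, (Γ.len_pos e).le]

/-- On a connected graph, vertex values vanishing on `D` are controlled by the differences along
the edges. -/
lemma Connected.exists_vertex_bound [Finite V] [Fintype E] {Γ : MetricGraph V E}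
    (hΓ : Γ.Connected) {D : Set V} (hD : D.Nonempty) :
    ∃ N : ℝ, 0 ≤ N ∧ ∀ (c : V → ℝ) (t : E → ℝ),
      (∀ e, |c (Γ.term e) - c (Γ.init e)| ≤ t e) → (∀ w ∈ D, c w = 0) →
      ∀ v, |c v| ≤ N * ∑ e, t e := by
  obtain ⟨d, hd⟩ := hD
  cases nonempty_fintype V
  -- Here `n` counts the edge traversals of a walk from `v` to `w`. It is chosen before `c` and `t`,
  -- and each traversal is charged the whole sum of `t`.
  have key : ∀ v w : V, ∃ n : ℕ, ∀ (c : V → ℝ) (t : E → ℝ),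
      (∀ e, |c (Γ.term e) - c (Γ.init e)| ≤ t e) → |c v - c w| ≤ n * ∑ e, t e := by
    intro v w
    induction hΓ v w with
    | rel x y h =>
      obtain ⟨e, rfl, rfl⟩ := h
      refine ⟨1, fun c t ht => ?_⟩
      rw [abs_sub_comm, Nat.cast_one, one_mul]
      exact (ht e).trans (Finset.single_le_sum (f := t)
        (fun i _ => (abs_nonneg _).trans (ht i)) (Finset.mem_univ e))
    | refl x => exact ⟨0, fun c t _ => by simp⟩
    | symm x y _ ih =>
      obtain ⟨n, hn⟩ := ih
      exact ⟨n, fun c t ht => by rw [abs_sub_comm]; exact hn c t ht⟩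
    | trans x y z _ _ ih1 ih2 =>
      obtain ⟨n, hn⟩ := ih1
      obtain ⟨m, hm⟩ := ih2
      refine ⟨n + m, fun c t ht => (abs_sub_le _ (c y) _).trans ?_⟩
      push_cast
      linarith [hn c t ht, hm c t ht]
  choose n hn using fun v => key v d
  refine ⟨∑ v, (n v : ℝ), by positivity, fun c t ht hc v => ?_⟩
  have h := hn v c t ht
  rw [hc d hd, sub_zero] at h
  refine h.trans (mul_le_mul_of_nonneg_right ?_
    (Finset.sum_nonneg fun i _ => (abs_nonneg _).trans (ht i)))
  exact Finset.single_le_sum (f := fun v => (n v : ℝ)) (fun _ _ => by positivity)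
    (Finset.mem_univ v)

section Admissible

variable {Γ : MetricGraph V E} {D : Set V} {p : ℝ} {u u' : E → ℝ → ℝ}

lemma IsAdmissible.continuousOn (h : Γ.IsAdmissible D p u u') (e : E) :
    ContinuousOn (u e) (Icc 0 (Γ.len e)) := by
  obtain ⟨⟨c, hc, -⟩, -⟩ := h
  exact (hc e).1

lemma IsAdmissible.memL1 (h : Γ.IsAdmissible D p u u') : Γ.MemL1 u :=
  fun e => Γ.integrable_of_continuousOn (h.continuousOn e)

lemma IsAdmissible.integrable_deriv (hp : 1 ≤ p) (h : Γ.IsAdmissible D p u u') (e : E) :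
    Integrable (u' e) (Γ.edgeMeasure e) :=
  (h.2.1 e).2.1.integrable (by rw [← ENNReal.ofReal_one]; exact ENNReal.ofReal_le_ofReal hp)

lemma IsAdmissible.eq_add_integral (hp : 1 ≤ p) (h : Γ.IsAdmissible D p u u') {e : E} {x : ℝ}
    (hx : x ∈ Icc 0 (Γ.len e)) : u e x = u e 0 + ∫ t in (0 : ℝ)..x, u' e t :=
  (h.2.1 e).2.2.eq_add_integral (Γ.len_pos e) (h.continuousOn e) (h.integrable_deriv hp e) hx

lemma IsAdmissible.abs_sub_le (hp : 1 ≤ p) (h : Γ.IsAdmissible D p u u') {e : E} {x : ℝ}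
    (hx : x ∈ Icc 0 (Γ.len e)) : |u e x - u e 0| ≤ ∫ t, |u' e t| ∂(Γ.edgeMeasure e) := by
  rw [h.eq_add_integral hp hx, add_sub_cancel_left, intervalIntegral.integral_of_le hx.1,
    integral_Ioc_eq_integral_Ioo]
  refine abs_integral_le_integral_abs.trans ?_
  exact setIntegral_mono_set (h.integrable_deriv hp e).abs
    (Eventually.of_forall fun x => abs_nonneg _) (Ioo_subset_Ioo_right hx.2).eventuallyLE

lemma IsAdmissible.powIntegral_pos [Fintype E] (h : Γ.IsAdmissible D p u u') {q : ℝ}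
    (hq : 0 < q) : 0 < Γ.powIntegral q u := by
  obtain ⟨e, x, hx, hne⟩ := h.2.2
  have hnn : ∀ e, 0 ≤ ∫ x, |u e x| ^ q ∂(Γ.edgeMeasure e) := fun e =>
    integral_nonneg fun x => Real.rpow_nonneg (abs_nonneg _) _
  refine lt_of_lt_of_le ?_ (Finset.single_le_sum (fun i _ => hnn i) (Finset.mem_univ e))
  refine lt_of_le_of_ne (hnn e) fun h0 => hne ?_
  have hi : Integrable (fun x => |u e x| ^ q) (Γ.edgeMeasure e) :=
    Γ.integrable_of_continuousOn ((h.continuousOn e).abs.rpow_const fun x _ => Or.inr hq.le)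
  have h1 := (integral_eq_zero_iff_of_nonneg
    (fun x => Real.rpow_nonneg (abs_nonneg _) _) hi).1 h0.symm
  refine eqOn_zero_of_ae_eq_zero (Γ.len_pos e) (h.continuousOn e) ?_ x hx
  filter_upwards [h1] with x hx
  have := (Real.rpow_eq_zero (abs_nonneg _) hq.ne').1 hx
  exact abs_eq_zero.1 this

lemma powIntegral_one [Fintype E] (Γ : MetricGraph V E) (u : E → ℝ → ℝ) :
    Γ.powIntegral 1 u = Γ.normL1 u := by
  simp [powIntegral, normL1]

lemma IsAdmissible.normL1_pos [Fintype E] (h : Γ.IsAdmissible D p u u') :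
    0 < Γ.normL1 u := by
  rw [← powIntegral_one]; exact h.powIntegral_pos one_pos

lemma normL1_nonneg [Fintype E] (Γ : MetricGraph V E) (u : E → ℝ → ℝ) : 0 ≤ Γ.normL1 u :=
  Finset.sum_nonneg fun _ _ => integral_nonneg fun _ => abs_nonneg _

lemma powIntegral_nonneg [Fintype E] (Γ : MetricGraph V E) (p : ℝ) (u : E → ℝ → ℝ) :
    0 ≤ Γ.powIntegral p u :=
  Finset.sum_nonneg fun _ _ => integral_nonneg fun _ => Real.rpow_nonneg (abs_nonneg _) _

/-- The values at the vertices and along the edges of a function vanishing on `D` are controlled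
by the `L¹` norm of its derivative. -/
lemma Connected.exists_sup_bound [Finite V] [Fintype E] (hΓ : Γ.Connected) (hD : D.Nonempty) :
    ∃ N : ℝ, 0 < N ∧ ∀ (p : ℝ) (u u' : E → ℝ → ℝ), 1 ≤ p → Γ.IsAdmissible D p u u' →
      (∀ e, ∀ x ∈ Icc 0 (Γ.len e), |u e x| ≤ N * Γ.normL1 u') ∧
      ∀ c : V → ℝ, Γ.IsContinuous u c → (∀ v ∈ D, c v = 0) →
        ∀ v, |c v| ≤ N * Γ.normL1 u' := by
  obtain ⟨N, hN0, hN⟩ := hΓ.exists_vertex_bound hD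
  -- The extra `1` pays for moving from a vertex into the interior of an edge.
  refine ⟨N + 1, by positivity, fun p u u' hp h => ?_⟩
  have hc : ∀ c : V → ℝ, Γ.IsContinuous u c → (∀ v ∈ D, c v = 0) →
      ∀ v, |c v| ≤ N * Γ.normL1 u' := by
    intro c hc hcD
    refine hN c (fun e => ∫ t, |u' e t| ∂(Γ.edgeMeasure e)) (fun e => ?_) hcD
    rw [← (hc e).2.1, ← (hc e).2.2]
    exact h.abs_sub_le hp (right_mem_Icc.2 (Γ.len_pos e).le)
  refine ⟨fun e x hx => ?_, fun c hc1 hc2 v => (hc c hc1 hc2 v).trans ?_⟩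
  · obtain ⟨c, hc1, hc2⟩ := h.1
    have h1 := hc c hc1 hc2 (Γ.init e)
    rw [← (hc1 e).2.1] at h1
    have h2 := h.abs_sub_le hp hx
    have h3 : ∫ t, |u' e t| ∂(Γ.edgeMeasure e) ≤ Γ.normL1 u' :=
      Finset.single_le_sum (f := fun e => ∫ t, |u' e t| ∂(Γ.edgeMeasure e))
        (fun _ _ => integral_nonneg fun _ => abs_nonneg _) (Finset.mem_univ e)
    have h4 := abs_add_le (u e x - u e 0) (u e 0)
    rw [sub_add_cancel] at h4
    linarith
  · nlinarith [Γ.normL1_nonneg u']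

/-- Comparison of the quotients with exponents `1` and `p`. -/
lemma Connected.exists_quotient_bound [Finite V] [Fintype E] [Nonempty E] (hΓ : Γ.Connected)
    (hD : D.Nonempty) :
    ∃ K : ℝ, 0 < K ∧ ∀ (p : ℝ) (u u' : E → ℝ → ℝ), 1 < p → Γ.IsAdmissible D p u u' →
      Γ.normL1 u' / Γ.normL1 u ≤ K ^ (p - 1) * (Γ.powIntegral p u' / Γ.powIntegral p u) := by
  obtain ⟨N, hN0, hN⟩ := hΓ.exists_sup_bound hD
  set L := ∑ e, Γ.len e with hL
  have hL0 : 0 < L := Finset.sum_pos (fun e _ => Γ.len_pos e) Finset.univ_nonempty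
  refine ⟨N * L, by positivity, fun p u u' hp h => ?_⟩
  have hp0 : 0 < p := one_pos.trans hp
  set T := Γ.normL1 u' with hT
  obtain ⟨hsup, -⟩ := hN p u u' hp.le h
  have hT0 : 0 < T := by
    obtain ⟨e, x, hx, hne⟩ := h.2.2
    have := (abs_pos.2 hne).trans_le (hsup e x hx)
    exact pos_of_mul_pos_right this hN0.le
  have hU0 := h.normL1_pos
  have hP0 := h.powIntegral_pos hp0
  have hnum : L * (T / L) ^ p ≤ Γ.powIntegral p u' := by
    -- Tangent at the mean value of `|u'|` over the graph: after summation over the edges the linear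
    -- terms cancel.
    set t := T / L with ht
    have ht0 : 0 < t := div_pos hT0 hL0
    have hLt : L * t = T := by rw [ht]; field_simp
    have hedge : ∀ e, Γ.len e * (t ^ p - p * t ^ (p - 1) * t) +
        p * t ^ (p - 1) * ∫ x, |u' e x| ∂(Γ.edgeMeasure e) ≤
        ∫ x, |u' e x| ^ p ∂(Γ.edgeMeasure e) := by
      intro e
      have hi := (h.integrable_deriv hp.le e).abs
      have hip : Integrable (fun x => |u' e x| ^ p) (Γ.edgeMeasure e) := by
        have := (h.2.1 e).2.1.integrable_norm_rpow (by simpa using hp0) ENNReal.ofReal_ne_top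
        rwa [ENNReal.toReal_ofReal hp0.le] at this
      rw [← integral_const_edgeMeasure, ← integral_const_mul,
        ← integral_add (integrable_const _) (hi.const_mul _)]
      refine integral_mono ((integrable_const _).add (hi.const_mul _)) hip fun x => ?_
      have := rpow_tangent_le hp.le (abs_nonneg (u' e x)) ht0
      simp only
      linarith
    have hsum := Finset.sum_le_sum fun e (_ : e ∈ Finset.univ) => hedge e
    rw [Finset.sum_add_distrib, ← Finset.sum_mul, ← Finset.mul_sum] at hsum
    refine le_trans (le_of_eq ?_) hsum
    change L * t ^ p = L * _ + p * t ^ (p - 1) * T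
    rw [← hLt]; ring
  have hden : Γ.powIntegral p u ≤ (N * T) ^ (p - 1) * Γ.normL1 u := by
    unfold powIntegral normL1
    rw [Finset.mul_sum]
    refine Finset.sum_le_sum fun e _ => ?_
    rw [← integral_const_mul]
    refine integral_mono_ae (Γ.integrable_of_continuousOn
      ((h.continuousOn e).abs.rpow_const fun x _ => Or.inr hp0.le))
      ((h.memL1 e).abs.const_mul _) ?_
    filter_upwards [Γ.ae_edgeMeasure e] with x hx
    rcases eq_or_ne (u e x) 0 with h0 | h0
    · simp [h0, Real.zero_rpow hp0.ne']
    · have h1 : |u e x| ^ p = |u e x| ^ (p - 1) * |u e x| := by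
        rw [Real.rpow_sub_one (abs_pos.2 h0).ne', div_mul_cancel₀ _ (abs_pos.2 h0).ne']
      rw [h1]
      exact mul_le_mul_of_nonneg_right (Real.rpow_le_rpow (abs_nonneg _)
        (hsup e x (Ioo_subset_Icc_self hx)) (by linarith)) (abs_nonneg _)
  rw [div_le_iff₀ hU0, mul_div_assoc', div_mul_eq_mul_div, le_div_iff₀ hP0]
  -- By homogeneity `T * T ^ (p - 1) = T ^ p` is absorbed by the numerator bound, leaving a constant
  -- independent of `u`.
  calc T * Γ.powIntegral p u ≤ T * ((N * T) ^ (p - 1) * Γ.normL1 u) := by gcongr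
    _ = (N * L) ^ (p - 1) * (L * (T / L) ^ p) * Γ.normL1 u := by
        rw [Real.mul_rpow hN0.le hT0.le, Real.mul_rpow hN0.le hL0.le, Real.div_rpow hT0.le hL0.le,
          Real.rpow_sub_one hT0.ne', Real.rpow_sub_one hL0.ne']
        have := Real.rpow_pos_of_pos hL0 p
        field_simp
    _ ≤ _ := by gcongr

/-- A function in `W^{1,p}` is of bounded variation. -/
lemma IsAdmissible.totalVariation_le [Fintype E] (hp : 1 ≤ p) (h : Γ.IsAdmissible D p u u')
    {c : V → ℝ} (hc : Γ.IsContinuous u c) (e : E) :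
    lineVariation (Γ.edgeExtension u c e) ≤
      ENNReal.ofReal (∫ x, |u' e x| ∂(Γ.edgeMeasure e)) := by
  have := lineVariation_extendByConst_le (Γ.len_pos e) (h.continuousOn e)
    (h.integrable_deriv hp e) fun x hx => h.eq_add_integral hp hx
  rwa [(hc e).2.1, (hc e).2.2] at this

/-- The vertex values of the continuous function are used, so no jumps contribute. -/
lemma IsAdmissible.exists_isAdmissibleBV [Fintype E] (hp : 1 ≤ p) (h : Γ.IsAdmissible D p u u') :
    ∃ c : V → ℝ, Γ.IsAdmissibleBV D u c ∧ (Γ.totalVariation u c).toReal ≤ Γ.normL1 u' := by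
  obtain ⟨c, hc, hcD⟩ := h.1
  have hle : Γ.totalVariation u c ≤ ENNReal.ofReal (Γ.normL1 u') := by
    unfold totalVariation normL1
    rw [ENNReal.ofReal_sum_of_nonneg fun _ _ => integral_nonneg fun _ => abs_nonneg _]
    exact Finset.sum_le_sum fun e _ => h.totalVariation_le hp hc e
  refine ⟨c, ⟨h.memL1, hle.trans_lt ENNReal.ofReal_lt_top, hcD, ?_⟩,
    ENNReal.toReal_le_of_le_ofReal (Γ.normL1_nonneg u') hle⟩
  obtain ⟨e, x, hx, hne⟩ := h.2.2
  exact ⟨e, fun h0 => hne (eqOn_zero_of_ae_eq_zero (Γ.len_pos e) (h.continuousOn e) h0 x hx)⟩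

/-- Smooth functions on the edges that fit together at the vertices are admissible. -/
lemma isAdmissible_of_contDiff {G : E → ℝ → ℝ} (hG : ∀ e, ContDiff ℝ ∞ (G e)) {c : V → ℝ}
    (h0 : ∀ e, G e 0 = c (Γ.init e)) (h1 : ∀ e, G e (Γ.len e) = c (Γ.term e))
    (hc : ∀ v ∈ D, c v = 0) (hne : ∃ e, ∃ x ∈ Icc 0 (Γ.len e), G e x ≠ 0) (p : ℝ) :
    Γ.IsAdmissible D p G (fun e => deriv (G e)) := by
  have hmem : ∀ (e : E) (f : ℝ → ℝ), Continuous f →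
      MemLp f (ENNReal.ofReal p) (Γ.edgeMeasure e) := by
    intro e f hf
    obtain ⟨C, hC⟩ := isCompact_Icc.exists_bound_of_continuousOn
      (hf.continuousOn (s := Icc 0 (Γ.len e)))
    refine MemLp.of_bound hf.aestronglyMeasurable C ?_
    filter_upwards [Γ.ae_edgeMeasure e] with x hx using hC x (Ioo_subset_Icc_self hx)
  refine ⟨⟨c, fun e => ⟨(hG e).continuous.continuousOn, h0 e, h1 e⟩, hc⟩, fun e => ?_, hne⟩
  have hG' : Continuous (deriv (G e)) := (hG e).continuous_deriv (by simp)
  refine ⟨hmem e _ (hG e).continuous, hmem e _ hG', fun φ hφ _ hφs => ?_⟩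
  have hφ0 : φ 0 = 0 := image_eq_zero_of_notMem_tsupport fun h => lt_irrefl _ (hφs h).1
  have hφl : φ (Γ.len e) = 0 := image_eq_zero_of_notMem_tsupport fun h => lt_irrefl _ (hφs h).2
  have hφ' : Continuous (deriv φ) := hφ.continuous_deriv (by simp)
  rw [setIntegral_Ioo_eq_intervalIntegral (Γ.len_pos e).le (fun x => G e x * deriv φ x),
    setIntegral_Ioo_eq_intervalIntegral (Γ.len_pos e).le (fun x => deriv (G e) x * φ x),
    intervalIntegral.integral_mul_deriv_eq_deriv_mul
      (fun x _ => ((hG e).differentiable (by simp) x).hasDerivAt)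
      (fun x _ => (hφ.differentiable (by simp) x).hasDerivAt)
      (hG'.intervalIntegrable _ _) (hφ'.intervalIntegrable _ _), hφ0, hφl]
  ring

/-- Guarantees that the infima run over nonempty sets; the real `sInf` of the empty set would be
`0`. The witness vanishes at every vertex. -/
lemma exists_isAdmissible [Nonempty E] (Γ : MetricGraph V E) (D : Set V) (p : ℝ) :
    ∃ u u' : E → ℝ → ℝ, Γ.IsAdmissible D p u u' := by
  obtain ⟨e⟩ := ‹Nonempty E›
  refine ⟨fun e x => x * (Γ.len e - x), _, isAdmissible_of_contDiff (c := fun _ => 0)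
    (fun e => contDiff_id.mul (contDiff_const.sub contDiff_id)) (by simp) (by simp) (by simp) ?_ p⟩
  have := Γ.len_pos e
  exact ⟨e, Γ.len e / 2, ⟨by linarith, by linarith⟩, (mul_pos (half_pos this) (sub_pos.2 (half_lt_self this))).ne'⟩

end Admissible

/-! ### Convergence of the eigenvalues -/

section Values

variable [Fintype E] (Γ : MetricGraph V E) (D : Set V)

lemma bddBelow_firstEigenvalue (p : ℝ) : BddBelow {r : ℝ | ∃ u u' : E → ℝ → ℝ,
    Γ.IsAdmissible D p u u' ∧ r = Γ.powIntegral p u' / Γ.powIntegral p u} := by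
  refine ⟨0, ?_⟩
  rintro r ⟨u, u', -, rfl⟩
  exact div_nonneg (Γ.powIntegral_nonneg p u') (Γ.powIntegral_nonneg p u)

lemma bddBelow_cheegerValue : BddBelow {r : ℝ | ∃ (v : E → ℝ → ℝ) (c : V → ℝ),
    Γ.IsAdmissibleBV D v c ∧ r = (Γ.totalVariation v c).toReal / Γ.normL1 v} := by
  refine ⟨0, ?_⟩
  rintro r ⟨v, c, -, rfl⟩
  exact div_nonneg ENNReal.toReal_nonneg (Γ.normL1_nonneg v)

variable {Γ D}

lemma IsAdmissibleBV.cheegerValue_le {v : E → ℝ → ℝ} {c : V → ℝ} (h : Γ.IsAdmissibleBV D v c) :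
    Γ.cheegerValue D ≤ (Γ.totalVariation v c).toReal / Γ.normL1 v :=
  csInf_le (Γ.bddBelow_cheegerValue D) ⟨v, c, h, rfl⟩

lemma IsAdmissible.cheegerValue_le {p : ℝ} {u u' : E → ℝ → ℝ} (hp : 1 ≤ p)
    (h : Γ.IsAdmissible D p u u') : Γ.cheegerValue D ≤ Γ.normL1 u' / Γ.normL1 u := by
  obtain ⟨c, hc, hle⟩ := h.exists_isAdmissibleBV hp
  exact hc.cheegerValue_le.trans (div_le_div_of_nonneg_right hle (Γ.normL1_nonneg u))

lemma tendsto_powIntegral {h : E → ℝ → ℝ} (hc : ∀ e, Continuous (h e)) :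
    Tendsto (fun p => Γ.powIntegral p h) (𝓝[>] 1) (𝓝 (Γ.normL1 h)) := by
  rw [← powIntegral_one]
  refine tendsto_finsetSum _ fun e _ => ?_
  obtain ⟨C, hC⟩ := isCompact_Icc.exists_bound_of_continuousOn
    ((hc e).continuousOn (s := Icc 0 (Γ.len e)))
  -- The base is at least `1`, so its powers increase with the exponent and those with `p < 2` are
  -- dominated by the square.
  refine tendsto_integral_filter_of_dominated_convergence (fun _ => (|C| + 1) ^ (2 : ℝ)) ?_ ?_
    (integrable_const _) ?_
  · filter_upwards [self_mem_nhdsWithin] with p hp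
    exact ((hc e).abs.rpow_const fun x => Or.inr
      (zero_le_one.trans (le_of_lt hp))).aestronglyMeasurable
  · filter_upwards [Ioo_mem_nhdsGT (by norm_num : (1 : ℝ) < 2)] with p hp
    filter_upwards [Γ.ae_edgeMeasure e] with x hx
    have h1 : |h e x| ≤ |C| + 1 := by
      have h2 := hC x (Ioo_subset_Icc_self hx)
      rw [Real.norm_eq_abs] at h2
      linarith [le_abs_self C]
    rw [Real.norm_eq_abs, abs_of_nonneg (Real.rpow_nonneg (abs_nonneg _) _)]
    calc |h e x| ^ p ≤ (|C| + 1) ^ p :=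
          Real.rpow_le_rpow (abs_nonneg _) h1 (by linarith [hp.1])
      _ ≤ (|C| + 1) ^ (2 : ℝ) :=
          Real.rpow_le_rpow_of_exponent_le (by linarith [abs_nonneg C]) hp.2.le
  · refine Eventually.of_forall fun x => Tendsto.mono_left ?_ nhdsWithin_le_nhds
    exact (Real.continuousAt_const_rpow' one_ne_zero).tendsto

lemma Connected.exists_cheegerValue_le [Finite V] [Nonempty E] (hΓ : Γ.Connected)
    (hD : D.Nonempty) :
    ∃ K : ℝ, 0 < K ∧ (∀ p : ℝ, 1 < p →
      Γ.cheegerValue D ≤ K ^ (p - 1) * Γ.firstEigenvalue D p) ∧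
      ∀ (p : ℝ) (u u' : E → ℝ → ℝ), 1 < p → Γ.IsAdmissible D p u u' →
      Γ.normL1 u' / Γ.normL1 u ≤ K ^ (p - 1) * (Γ.powIntegral p u' / Γ.powIntegral p u) := by
  obtain ⟨K, hK0, hK⟩ := hΓ.exists_quotient_bound hD
  refine ⟨K, hK0, fun p hp => ?_, hK⟩
  have hKp := Real.rpow_pos_of_pos hK0 (p - 1)
  rw [← div_le_iff₀' hKp]
  obtain ⟨u, u', hu⟩ := Γ.exists_isAdmissible D p
  refine le_csInf ⟨_, u, u', hu, rfl⟩ ?_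
  rintro r ⟨u, u', hu, rfl⟩
  rw [div_le_iff₀' hKp]
  exact (hu.cheegerValue_le hp.le).trans (hK p u u' hp hu)

lemma IsAdmissibleBV.normL1_pos {v : E → ℝ → ℝ} {c : V → ℝ} (h : Γ.IsAdmissibleBV D v c) :
    0 < Γ.normL1 v := by
  obtain ⟨h1, -, -, e, he⟩ := h
  have hnn : ∀ e, 0 ≤ ∫ x, |v e x| ∂(Γ.edgeMeasure e) := fun e =>
    integral_nonneg fun x => abs_nonneg _
  refine lt_of_lt_of_le ?_ (Finset.single_le_sum (fun i _ => hnn i) (Finset.mem_univ e))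
  refine lt_of_le_of_ne (hnn e) fun h0 => he ?_
  filter_upwards [(integral_eq_zero_iff_of_nonneg (fun x => abs_nonneg _) (h1 e).abs).1 h0.symm]
    with x hx
  exact abs_eq_zero.1 hx

/-- A nearly optimal BV function is replaced by a smooth one whose `1`-quotient is still below `μ`.
That one function competes for every `p`, and its `p`-quotients converge. -/
lemma eventually_firstEigenvalue_lt [Nonempty E] {μ : ℝ} (hμ : Γ.cheegerValue D < μ) :
    ∀ᶠ p in 𝓝[>] 1, Γ.firstEigenvalue D p < μ := by
  obtain ⟨u, u', hu⟩ := Γ.exists_isAdmissible D 1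
  obtain ⟨c₀, hc₀, -⟩ := hu.exists_isAdmissibleBV le_rfl
  unfold cheegerValue at hμ
  obtain ⟨r, ⟨v, c, hv, rfl⟩, hr⟩ := exists_lt_of_csInf_lt (by exact ⟨_, u, c₀, hc₀, rfl⟩) hμ
  set T := (Γ.totalVariation v c).toReal with hT
  set U := Γ.normL1 v with hU
  have hU0 : 0 < U := hv.normL1_pos
  have hT0 : 0 ≤ T := ENNReal.toReal_nonneg
  have hμ0 : 0 < μ := (div_nonneg hT0 hU0.le).trans_lt hr
  have hTU : T / μ < U := by rw [div_lt_comm₀ hμ0 hU0]; exact hr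
  set m : ℝ := ((Fintype.card E : ℕ) : ℝ) with hm
  have hm0 : 0 < m := by rw [hm]; exact_mod_cast Fintype.card_pos
  -- The losses on the `m` edges together use up half of the available gap `U - T / μ`.
  set δ := (U - T / μ) / (2 * m) with hδ
  have hδ0 : 0 < δ := div_pos (by linarith) (by positivity)
  have hfin : ∀ e, lineVariation (Γ.edgeExtension v c e) ≠ ⊤ := fun e =>
    (ENNReal.sum_lt_top.1 hv.2.1 e (Finset.mem_univ e)).ne
  choose G hG hG0 hG1 hGT hGU using fun e =>
    exists_contDiff_approx (Γ.len_pos e) (hv.1 e) (hfin e) hδ0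
  have hT' : Γ.normL1 (fun e => deriv (G e)) ≤ T := by
    rw [hT, totalVariation, ENNReal.toReal_sum fun e _ => hfin e]
    exact Finset.sum_le_sum fun e _ => hGT e
  have hU' : T / μ < Γ.normL1 G := by
    have h1 : U - m * δ ≤ Γ.normL1 G := by
      have := Finset.sum_le_sum fun e (_ : e ∈ Finset.univ) => hGU e
      rw [Finset.sum_sub_distrib, Finset.sum_const, Finset.card_univ, nsmul_eq_mul] at this
      exact this
    have h2 : m * δ = (U - T / μ) / 2 := by rw [hδ]; field_simp
    linarith
  have hU'0 : 0 < Γ.normL1 G := (div_nonneg hT0 hμ0.le).trans_lt hU'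
  have hne : ∃ e, ∃ x ∈ Icc 0 (Γ.len e), G e x ≠ 0 := by
    by_contra! hcon
    refine hU'0.ne' (Finset.sum_eq_zero fun e _ => ?_)
    refine integral_eq_zero_of_ae ?_
    filter_upwards [Γ.ae_edgeMeasure e] with x hx
    simp [hcon e x (Ioo_subset_Icc_self hx)]
  have hadm := fun p => isAdmissible_of_contDiff (D := D) hG hG0 hG1 hv.2.2.1 hne p
  have hlim := (Γ.tendsto_powIntegral fun e => (hG e).continuous_deriv (by simp)).div
    (Γ.tendsto_powIntegral fun e => (hG e).continuous) hU'0.ne'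
  have hlt : Γ.normL1 (fun e => deriv (G e)) / Γ.normL1 G < μ := by
    rw [div_lt_iff₀ hU'0]
    rw [div_lt_iff₀ hμ0] at hU'
    linarith
  filter_upwards [hlim.eventually (gt_mem_nhds hlt)] with p hp
  exact (csInf_le (Γ.bddBelow_firstEigenvalue D p) ⟨_, _, hadm p, rfl⟩).trans_lt hp

/-- Convergence of the first eigenvalues. -/
lemma Connected.tendsto_firstEigenvalue [Finite V] [Nonempty E] (hΓ : Γ.Connected)
    (hD : D.Nonempty) :
    Tendsto (fun p : ℝ => Γ.firstEigenvalue D p) (𝓝[>] 1) (𝓝 (Γ.cheegerValue D)) := by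
  obtain ⟨K, hK0, hK, -⟩ := hΓ.exists_cheegerValue_le hD
  refine tendsto_order.2 ⟨fun a ha => ?_, fun a ha => eventually_firstEigenvalue_lt ha⟩
  have hlim : Tendsto (fun p : ℝ => Γ.cheegerValue D / K ^ (p - 1)) (𝓝[>] 1)
      (𝓝 (Γ.cheegerValue D)) := by
    have h1 : Tendsto (fun p : ℝ => K ^ (p - 1)) (𝓝 1) (𝓝 (K ^ ((1 : ℝ) - 1))) :=
      (Real.continuousAt_const_rpow hK0.ne').tendsto.comp (tendsto_id.sub_const 1)
    rw [sub_self, Real.rpow_zero] at h1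
    have h2 := (tendsto_const_nhds (x := Γ.cheegerValue D)).div h1 one_ne_zero
    rw [div_one] at h2
    exact h2.mono_left nhdsWithin_le_nhds
  filter_upwards [hlim.eventually (lt_mem_nhds ha), self_mem_nhdsWithin] with p hp hp1
  refine hp.trans_le ?_
  rw [div_le_iff₀' (Real.rpow_pos_of_pos hK0 _)]
  exact hK p hp1

end Values

end MetricGraph

/-! ### Compactness and lower semicontinuity -/

/-- The `L¹` norm of an absolutely continuous function is controlled by its values on a grid and
the mesh times its variation. -/
lemma integral_abs_le_grid {l : ℝ} (hl : 0 < l) {f g : ℝ → ℝ} (hf : ContinuousOn f (Icc 0 l))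
    (hg : Integrable g (volume.restrict (Ioo 0 l)))
    (h : ∀ x ∈ Icc 0 l, f x = f 0 + ∫ t in (0 : ℝ)..x, g t) (k : ℕ) :
    ∫ x in Ioo 0 l, |f x| ≤ l / (k + 1) *
      ((∑ i ∈ Finset.range (k + 1), |f (i * (l / (k + 1)))|) + ∫ x in Ioo 0 l, |g x|) := by
  set m := l / ((k : ℝ) + 1) with hm
  have hm0 : 0 < m := by positivity
  have hkm : ((k : ℝ) + 1) * m = l := by rw [hm]; field_simp
  set a : ℕ → ℝ := fun i => i * m with ha
  have ha0 : a 0 = 0 := by simp [ha]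
  have hal : a (k + 1) = l := by simp only [ha]; push_cast; exact hkm
  have hstep : ∀ i, a (i + 1) = a i + m := fun i => by simp only [ha]; push_cast; ring
  have hle : ∀ i, a i ≤ a (i + 1) := fun i => by rw [hstep]; linarith
  have hsub : ∀ i < k + 1, Icc (a i) (a (i + 1)) ⊆ Icc 0 l := by
    intro i hi
    refine Icc_subset_Icc (by positivity) ?_
    rw [← hal]
    exact mul_le_mul_of_nonneg_right (by exact_mod_cast hi) hm0.le
  have hg' := (intervalIntegrable_iff_integrable_restrict_Ioo hl.le).2 hg
  have hgi : ∀ {x y : ℝ}, x ≤ y → Icc x y ⊆ Icc 0 l → IntervalIntegrable g volume x y := by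
    intro x y hxy hs
    refine hg'.mono_set ?_
    rwa [uIcc_of_le hxy, uIcc_of_le hl.le]
  have hfi : ∀ i < k + 1, IntervalIntegrable (fun x => |f x|) volume (a i) (a (i + 1)) := by
    intro i hi
    refine ContinuousOn.intervalIntegrable ?_
    rw [uIcc_of_le (hle i)]
    exact (hf.mono (hsub i hi)).abs
  have hgai : ∀ i < k + 1, IntervalIntegrable (fun x => |g x|) volume (a i) (a (i + 1)) :=
    fun i hi => (hgi (hle i) (hsub i hi)).abs
  have hcell : ∀ i ∈ Finset.range (k + 1), ∫ x in (a i)..(a (i + 1)), |f x| ≤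
      m * (|f (a i)| + ∫ x in (a i)..(a (i + 1)), |g x|) := by
    intro i hi
    rw [Finset.mem_range] at hi
    have hpt : ∀ x ∈ Icc (a i) (a (i + 1)),
        |f x| ≤ |f (a i)| + ∫ x in (a i)..(a (i + 1)), |g x| := by
      intro x hx
      have hx' := hsub i hi hx
      have hai := hsub i hi (left_mem_Icc.2 (hle i))
      have h1 : f x - f (a i) = ∫ t in (a i)..x, g t := by
        rw [h x hx', h _ hai, ← intervalIntegral.integral_add_adjacent_intervals
          (hgi hai.1 (Icc_subset_Icc_right hai.2))
          (hgi hx.1 (Icc_subset_Icc hai.1 hx'.2))]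
        ring
      have h2 : |f x - f (a i)| ≤ ∫ t in (a i)..x, |g t| := by
        rw [h1]; exact intervalIntegral.abs_integral_le_integral_abs hx.1
      have h3 : ∫ t in (a i)..x, |g t| ≤ ∫ x in (a i)..(a (i + 1)), |g x| :=
        intervalIntegral.integral_mono_interval le_rfl hx.1 hx.2
          (Eventually.of_forall fun t => abs_nonneg _) (hgai i hi)
      have h4 := abs_add_le (f x - f (a i)) (f (a i))
      rw [sub_add_cancel] at h4
      linarith
    refine (intervalIntegral.integral_mono_on (hle i) (hfi i hi)
      (intervalIntegrable_const) hpt).trans (le_of_eq ?_)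
    rw [intervalIntegral.integral_const, hstep, add_sub_cancel_left, smul_eq_mul]
  calc ∫ x in Ioo 0 l, |f x| = ∑ i ∈ Finset.range (k + 1), ∫ x in (a i)..(a (i + 1)), |f x| := by
        rw [intervalIntegral.sum_integral_adjacent_intervals hfi, ha0, hal,
          setIntegral_Ioo_eq_intervalIntegral hl.le (fun x => |f x|)]
    _ ≤ ∑ i ∈ Finset.range (k + 1), m * (|f (a i)| + ∫ x in (a i)..(a (i + 1)), |g x|) :=
        Finset.sum_le_sum hcell
    _ = _ := by
        rw [← Finset.mul_sum, Finset.sum_add_distrib,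
          intervalIntegral.sum_integral_adjacent_intervals hgai, ha0, hal,
          setIntegral_Ioo_eq_intervalIntegral hl.le (fun x => |g x|)]

lemma dist_toL1_toL1 {μ : Measure ℝ} {f g : ℝ → ℝ} (hf : Integrable f μ) (hg : Integrable g μ) :
    dist (hf.toL1 f) (hg.toL1 g) = ∫ x, |f x - g x| ∂μ := by
  rw [dist_eq_norm, ← Integrable.toL1_sub f g hf hg, L1.norm_of_fun_eq_integral_norm]
  rfl

/-- Tychonoff in place of a diagonal argument: a countable product of compact intervals is compact
and first countable, hence sequentially compact. -/
lemma exists_subseq_tendsto_of_abs_le {ι : Type*} [Countable ι] {s : ℕ → ι → ℝ} {M : ℝ}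
    (h : ∀ n i, |s n i| ≤ M) :
    ∃ (a : ι → ℝ) (φ : ℕ → ℕ), StrictMono φ ∧ ∀ i, Tendsto (fun n => s (φ n) i) atTop (𝓝 (a i)) := by
  have hK : IsCompact (univ.pi fun _ : ι => Icc (-M) M) :=
    isCompact_univ_pi fun _ => isCompact_Icc
  obtain ⟨a, -, φ, hφ, ha⟩ := hK.tendsto_subseq (x := s) fun n i _ => abs_le.1 (h n i)
  exact ⟨a, φ, hφ, fun i => (tendsto_pi_nhds.1 ha) i⟩

namespace MetricGraph

variable {V E : Type*} [Fintype E] {Γ : MetricGraph V E} {D : Set V}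

/-- Compactness in `L¹(Γ)` of bounded families of absolutely continuous functions. -/
lemma exists_subseq_tendsto_normL1 {u u' : ℕ → E → ℝ → ℝ} {M C : ℝ}
    (hu : ∀ n e, ContinuousOn (u n e) (Icc 0 (Γ.len e)))
    (hu' : ∀ n e, Integrable (u' n e) (Γ.edgeMeasure e))
    (h : ∀ n e, ∀ x ∈ Icc 0 (Γ.len e), u n e x = u n e 0 + ∫ t in (0 : ℝ)..x, u' n e t)
    (hM : ∀ n e, ∀ x ∈ Icc 0 (Γ.len e), |u n e x| ≤ M)
    (hC : ∀ n e, ∫ x, |u' n e x| ∂(Γ.edgeMeasure e) ≤ C) :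
    ∃ (φ : ℕ → ℕ) (u₁ : E → ℝ → ℝ), StrictMono φ ∧ Γ.MemL1 u₁ ∧
      Tendsto (fun j => Γ.normL1 (u (φ j) - u₁)) atTop (𝓝 0) := by
  have hgrid : ∀ e (k i : ℕ), i ≤ k → (i : ℝ) * (Γ.len e / (k + 1)) ∈ Icc 0 (Γ.len e) := by
    intro e k i hi
    have hl := Γ.len_pos e
    refine ⟨by positivity, ?_⟩
    have hik : (i : ℝ) ≤ k := by exact_mod_cast hi
    rw [mul_div_assoc', div_le_iff₀ (by positivity)]
    nlinarith
  -- One subsequence along which the values at all points of all uniform grids converge. The index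
  -- `(e, k, i)` stands for the `i`-th point of the grid with `k + 1` cells; the value `0` for `i >
  -- k` is a dummy.
  obtain ⟨a, φ, hφ, ha⟩ := exists_subseq_tendsto_of_abs_le (ι := E × ℕ × ℕ)
    (s := fun n j => if j.2.2 ≤ j.2.1 then
      u n j.1 ((j.2.2 : ℝ) * (Γ.len j.1 / ((j.2.1 : ℝ) + 1))) else 0) (M := |M|) (by
    rintro n ⟨e, k, i⟩
    simp only
    split_ifs with hi
    · exact (hM n e _ (hgrid e k i hi)).trans (le_abs_self M)
    · simp)
  have hint : ∀ n e, Integrable (u n e) (Γ.edgeMeasure e) := fun n e =>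
    Γ.integrable_of_continuousOn (hu n e)
  have hcauchy : ∀ e, CauchySeq fun n => (hint (φ n) e).toL1 (u (φ n) e) := by
    intro e
    have hl := Γ.len_pos e
    rw [Metric.cauchySeq_iff]
    intro ε hε
    have hlim : Tendsto (fun k : ℕ => Γ.len e * (1 / ((k : ℝ) + 1)) * (2 * |C|)) atTop
        (𝓝 (Γ.len e * 0 * (2 * |C|))) :=
      (tendsto_one_div_add_atTop_nhds_zero_nat.const_mul _).mul_const _
    rw [mul_zero, zero_mul] at hlim
    -- The mesh is fixed first, so that mesh times variation is below `ε / 2`; the finitely many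
    -- grid values then contribute `ε / 4` for each of the two functions.
    obtain ⟨k, hk⟩ := (hlim.eventually (gt_mem_nhds (half_pos hε))).exists
    set m := Γ.len e / ((k : ℝ) + 1) with hm
    have hm0 : 0 < m := by positivity
    have hk' : m * (2 * |C|) < ε / 2 := by rw [hm, div_eq_mul_one_div]; exact hk
    set b : ℕ → ℝ := fun i => a (e, k, i)
    have hconv : Tendsto (fun n => m * ∑ i ∈ Finset.range (k + 1), |u (φ n) e (i * m) - b i|)
        atTop (𝓝 0) := by
      have h0 : m * ∑ i ∈ Finset.range (k + 1), |b i - b i| = 0 := by simp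
      rw [← h0]
      refine (tendsto_finsetSum _ fun i hi => ?_).const_mul m
      have h1 := ha (e, k, i)
      simp only [Nat.lt_succ_iff.1 (Finset.mem_range.1 hi), if_true] at h1
      exact (h1.sub_const _).abs
    obtain ⟨N, hN⟩ := eventually_atTop.1 (hconv.eventually (gt_mem_nhds
      (by positivity : 0 < ε / 4)))
    refine ⟨N, fun n hn n' hn' => ?_⟩
    rw [dist_toL1_toL1]
    have hgi := integral_abs_le_grid hl ((hu (φ n) e).sub (hu (φ n') e))
      ((hu' (φ n) e).sub (hu' (φ n') e)) (fun x hx => by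
        have hi : ∀ n, IntervalIntegrable (u' n e) volume 0 x := fun n =>
          ((intervalIntegrable_iff_integrable_restrict_Ioo hl.le).2 (hu' n e)).mono_set (by
            rw [uIcc_of_le hx.1, uIcc_of_le hl.le]; exact Icc_subset_Icc_right hx.2)
        simp only [Pi.sub_apply]
        rw [intervalIntegral.integral_sub (hi _) (hi _), h _ e x hx, h (φ n') e x hx]
        ring) k
    simp only [Pi.sub_apply] at hgi
    refine lt_of_le_of_lt hgi ?_
    rw [mul_add]
    have h1 : m * ∑ i ∈ Finset.range (k + 1), |u (φ n) e (i * m) - u (φ n') e (i * m)| ≤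
        m * (∑ i ∈ Finset.range (k + 1), |u (φ n) e (i * m) - b i|) +
        m * ∑ i ∈ Finset.range (k + 1), |u (φ n') e (i * m) - b i| := by
      rw [← mul_add, ← Finset.sum_add_distrib]
      gcongr with i hi
      rw [abs_sub_comm (u (φ n') e (i * m)) (b i)]
      exact abs_sub_le _ _ _
    have h2 : ∫ x in Ioo 0 (Γ.len e), |u' (φ n) e x - u' (φ n') e x| ≤ 2 * |C| := by
      calc _ ≤ ∫ x in Ioo 0 (Γ.len e), (|u' (φ n) e x| + |u' (φ n') e x|) :=
            integral_mono ((hu' _ e).sub (hu' _ e)).abs ((hu' _ e).abs.add (hu' _ e).abs)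
              fun x => abs_sub _ _
        _ = (∫ x in Ioo 0 (Γ.len e), |u' (φ n) e x|) + ∫ x in Ioo 0 (Γ.len e), |u' (φ n') e x| :=
            integral_add (hu' _ e).abs (hu' _ e).abs
        _ ≤ 2 * |C| := by
            have h3 := hC (φ n) e
            have h4 := hC (φ n') e
            rw [edgeMeasure] at h3 h4
            linarith [le_abs_self C]
    have h3 := mul_le_mul_of_nonneg_left h2 hm0.le
    linarith [hN n hn, hN n' hn']
  choose F hF using fun e => cauchySeq_tendsto_of_complete (hcauchy e)
  have hFi : ∀ e, Integrable (F e) (Γ.edgeMeasure e) := fun e => L1.integrable_coeFn (F e)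
  refine ⟨φ, fun e => F e, hφ, hFi, ?_⟩
  have : Tendsto (fun j => ∑ e, dist ((hint (φ j) e).toL1 (u (φ j) e)) (F e)) atTop
      (𝓝 (∑ _e : E, (0 : ℝ))) :=
    tendsto_finsetSum _ fun e _ => tendsto_iff_dist_tendsto_zero.1 (hF e)
  rw [Finset.sum_const_zero] at this
  refine this.congr fun j => Finset.sum_congr rfl fun e _ => ?_
  have h1 := dist_toL1_toL1 (hint (φ j) e) (hFi e)
  rwa [Integrable.toL1_coeFn] at h1

lemma integral_abs_le_normL1 (Γ : MetricGraph V E) (u : E → ℝ → ℝ) (e : E) :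
    ∫ x, |u e x| ∂(Γ.edgeMeasure e) ≤ Γ.normL1 u :=
  Finset.single_le_sum (f := fun e => ∫ x, |u e x| ∂(Γ.edgeMeasure e))
    (fun _ _ => integral_nonneg fun _ => abs_nonneg _) (Finset.mem_univ e)

lemma normL1_le_add (Γ : MetricGraph V E) {u v : E → ℝ → ℝ} (hu : Γ.MemL1 u) (hv : Γ.MemL1 v) :
    Γ.normL1 u ≤ Γ.normL1 v + Γ.normL1 (u - v) := by
  unfold normL1
  rw [← Finset.sum_add_distrib]
  refine Finset.sum_le_sum fun e _ => ?_
  have hi : Integrable (fun x => |(u - v) e x|) (Γ.edgeMeasure e) := ((hu e).sub (hv e)).abs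
  rw [← integral_add (hv e).abs hi]
  refine integral_mono (hu e).abs ((hv e).abs.add hi) fun x => ?_
  have := abs_add_le (v e x) (u e x - v e x)
  rwa [add_sub_cancel] at this

lemma normL1_sub_comm (Γ : MetricGraph V E) (u v : E → ℝ → ℝ) :
    Γ.normL1 (u - v) = Γ.normL1 (v - u) := by
  simp only [normL1, Pi.sub_apply, abs_sub_comm]

/-- Lower semicontinuity of the variation along an edge. -/
lemma lineVariation_edgeExtension_le_of_tendsto {u : ℕ → E → ℝ → ℝ} {u₁ : E → ℝ → ℝ}
    {c : ℕ → V → ℝ} {c₁ : V → ℝ} {t : ℕ → ℝ} {τ : ℝ} (hu : ∀ n, Γ.MemL1 (u n))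
    (hu₁ : Γ.MemL1 u₁) (hlim : Tendsto (fun n => Γ.normL1 (u n - u₁)) atTop (𝓝 0))
    (hc : ∀ v, Tendsto (fun n => c n v) atTop (𝓝 (c₁ v))) (ht0 : ∀ n, 0 ≤ t n)
    (ht : Tendsto t atTop (𝓝 τ)) (e : E)
    (hle : ∀ n, lineVariation (Γ.edgeExtension (u n) (c n) e) ≤ ENNReal.ofReal (t n)) :
    lineVariation (Γ.edgeExtension u₁ c₁ e) ≤ ENNReal.ofReal τ := by
  refine iSup₂_le fun φ hφ => ENNReal.ofReal_le_ofReal ?_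
  have hl := Γ.len_pos e
  have hφ' : Continuous (deriv φ) := hφ.1.continuous_deriv le_rfl
  obtain ⟨C, hC⟩ := hφ.2.1.deriv.exists_bound_of_continuous hφ'
  have hn : ∀ n, ∫ x, Γ.edgeExtension (u n) (c n) e x * deriv φ x ≤ t n := fun n => by
    rw [← ENNReal.ofReal_le_ofReal_iff (ht0 n)]
    exact (le_iSup₂_of_le φ hφ le_rfl).trans (hle n)
  have hexp : ∀ (w : E → ℝ → ℝ) (b : V → ℝ), Γ.MemL1 w →
      ∫ x, Γ.edgeExtension w b e x * deriv φ x = b (Γ.init e) * φ 0 +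
        (∫ x, w e x * deriv φ x ∂(Γ.edgeMeasure e)) - b (Γ.term e) * φ (Γ.len e) :=
    fun w b hw => integral_extendByConst_mul_deriv hl _ _ (hw e) hφ.1 hφ.2.1
  have hmul : ∀ w : E → ℝ → ℝ, Γ.MemL1 w →
      Integrable (fun x => w e x * deriv φ x) (Γ.edgeMeasure e) := fun w hw =>
    (hw e).mul_bdd hφ'.aestronglyMeasurable (Eventually.of_forall hC)
  -- For a fixed test function `deriv φ` is bounded, so `L¹` convergence is enough.
  have hI : Tendsto (fun n => ∫ x, u n e x * deriv φ x ∂(Γ.edgeMeasure e)) atTop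
      (𝓝 (∫ x, u₁ e x * deriv φ x ∂(Γ.edgeMeasure e))) := by
    rw [tendsto_iff_dist_tendsto_zero]
    have hz : Tendsto (fun n => Γ.normL1 (u n - u₁) * C) atTop (𝓝 0) := by
      simpa using hlim.mul_const C
    refine squeeze_zero (fun _ => dist_nonneg) (fun n => ?_) hz
    have hC0 : 0 ≤ C := (norm_nonneg _).trans (hC 0)
    rw [Real.dist_eq, ← integral_sub (hmul _ (hu n)) (hmul _ hu₁)]
    refine abs_integral_le_integral_abs.trans ?_
    refine le_trans ?_ (mul_le_mul_of_nonneg_right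
      (Γ.integral_abs_le_normL1 (u n - u₁) e) hC0)
    rw [← integral_mul_const]
    refine integral_mono ((hmul _ (hu n)).sub (hmul _ hu₁)).abs
      (((hu n e).sub (hu₁ e)).abs.mul_const C) fun x => ?_
    simp only [Pi.sub_apply]
    rw [← sub_mul, abs_mul]
    exact mul_le_mul_of_nonneg_left (hC x) (abs_nonneg _)
  refine le_of_tendsto_of_tendsto' ?_ ht hn
  simp_rw [hexp _ _ (hu _)]
  rw [hexp _ _ hu₁]
  exact (((hc _).mul_const _).add hI).sub ((hc _).mul_const _)

end MetricGraph

/-! ### The main theorem -/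

theorem mainTheorem8 {V E : Type*} [Finite V] [Fintype E] [Nonempty E]
    (Γ : MetricGraph V E) (hΓ : Γ.Connected) (D : Set V) (hD : D.Nonempty) :
    Tendsto (fun p : ℝ => Γ.firstEigenvalue D p) (𝓝[>] 1) (𝓝 (Γ.cheegerValue D)) ∧
    ∀ u : ℝ → E → ℝ → ℝ,
      (∀ p : ℝ, 1 < p → Γ.IsFirstEigenfunction D p (u p) ∧ Γ.normL1 (u p) = 1) →
      (∃ (q : ℕ → ℝ) (u₁ : E → ℝ → ℝ), (∀ j, 1 < q j) ∧ Tendsto q atTop (𝓝 1) ∧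
        Γ.MemL1 u₁ ∧ Tendsto (fun j => Γ.normL1 (u (q j) - u₁)) atTop (𝓝 0)) ∧
      (∀ (q : ℕ → ℝ) (u₁ : E → ℝ → ℝ), (∀ j, 1 < q j) → Tendsto q atTop (𝓝 1) →
        Γ.MemL1 u₁ → Tendsto (fun j => Γ.normL1 (u (q j) - u₁)) atTop (𝓝 0) →
        Γ.IsMinimizerBV D u₁) := by
  have hmain := hΓ.tendsto_firstEigenvalue hD
  refine ⟨hmain, fun u hu => ?_⟩
  obtain ⟨K, hK0, -, hK⟩ := hΓ.exists_cheegerValue_le hD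
  obtain ⟨N, hN0, hN⟩ := hΓ.exists_sup_bound hD
  choose! u' hadm hratio using fun p hp => (hu p hp).1
  -- The right side tends to `Λ₁`: this gives both the bound needed for compactness and the sharp
  -- bound on the variation of the limit.
  have hT : ∀ p, 1 < p → Γ.normL1 (u' p) ≤ K ^ (p - 1) * Γ.firstEigenvalue D p := by
    intro p hp
    have h1 := hK p (u p) (u' p) hp (hadm p hp)
    rwa [hratio p hp, (hu p hp).2, div_one] at h1
  have hlim : Tendsto (fun p : ℝ => K ^ (p - 1) * Γ.firstEigenvalue D p) (𝓝[>] 1)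
      (𝓝 (Γ.cheegerValue D)) := by
    have h1 : Tendsto (fun p : ℝ => K ^ (p - 1)) (𝓝 1) (𝓝 (K ^ ((1 : ℝ) - 1))) :=
      (Real.continuousAt_const_rpow hK0.ne').tendsto.comp (tendsto_id.sub_const 1)
    rw [sub_self, Real.rpow_zero] at h1
    simpa using (h1.mono_left nhdsWithin_le_nhds).mul hmain
  have hseq : ∀ q : ℕ → ℝ, (∀ j, 1 < q j) → Tendsto q atTop (𝓝 1) →
      Tendsto (fun j => K ^ (q j - 1) * Γ.firstEigenvalue D (q j)) atTop
        (𝓝 (Γ.cheegerValue D)) := fun q hq1 hq =>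
    hlim.comp (tendsto_nhdsWithin_iff.2 ⟨hq, Eventually.of_forall hq1⟩)
  have hbd : ∀ q : ℕ → ℝ, (∀ j, 1 < q j) → Tendsto q atTop (𝓝 1) →
      ∃ C, ∀ j, Γ.normL1 (u' (q j)) ≤ C := by
    intro q hq1 hq
    obtain ⟨C, hC⟩ := (hseq q hq1 hq).bddAbove_range
    exact ⟨C, fun j => (hT _ (hq1 j)).trans (hC ⟨j, rfl⟩)⟩
  constructor
  · set q : ℕ → ℝ := fun j => 1 + 1 / ((j : ℝ) + 1) with hq
    have hq1 : ∀ j, 1 < q j := fun j => by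
      have : 0 < 1 / ((j : ℝ) + 1) := by positivity
      simp only [hq]; linarith
    have hqt : Tendsto q atTop (𝓝 1) := by
      have h1 := (tendsto_one_div_add_atTop_nhds_zero_nat (𝕜 := ℝ)).const_add 1
      rwa [add_zero] at h1
    obtain ⟨C, hC⟩ := hbd q hq1 hqt
    obtain ⟨φ, u₁, hφ, hu₁, hconv⟩ := MetricGraph.exists_subseq_tendsto_normL1 (Γ := Γ)
      (u := fun n => u (q n)) (u' := fun n => u' (q n)) (M := N * C) (C := C)
      (fun n e => (hadm _ (hq1 n)).continuousOn e)
      (fun n e => (hadm _ (hq1 n)).integrable_deriv (hq1 n).le e)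
      (fun n e x hx => (hadm _ (hq1 n)).eq_add_integral (hq1 n).le hx)
      (fun n e x hx => ((hN _ _ _ (hq1 n).le (hadm _ (hq1 n))).1 e x hx).trans
        (mul_le_mul_of_nonneg_left (hC n) hN0.le))
      (fun n e => (Γ.integral_abs_le_normL1 _ e).trans (hC n))
    exact ⟨q ∘ φ, u₁, fun j => hq1 _, hqt.comp hφ.tendsto_atTop, hu₁, hconv⟩
  · intro q u₁ hq1 hqt hu₁ hconv
    obtain ⟨C, hC⟩ := hbd q hq1 hqt
    choose c hc hcD using fun j => (hadm _ (hq1 j)).1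
    -- Vertex values and edgewise norms of the derivatives converge along a common subsequence.
    -- Passing to it does not change `u₁`; it only selects the vertex values `c₁`.
    obtain ⟨w, φ, hφ, hw⟩ := exists_subseq_tendsto_of_abs_le (ι := V ⊕ E)
      (s := fun n => Sum.elim (c n) fun e => ∫ x, |u' (q n) e x| ∂(Γ.edgeMeasure e))
      (M := (N + 1) * C) (by
        rintro n (v | e)
        · have h0 := (Γ.normL1_nonneg (u' (q n))).trans (hC n)
          refine ((hN _ _ _ (hq1 n).le (hadm _ (hq1 n))).2 (c n) (hc n) (hcD n) v).trans ?_
          nlinarith [mul_le_mul_of_nonneg_left (hC n) hN0.le]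
        · have h0 := (Γ.normL1_nonneg (u' (q n))).trans (hC n)
          simp only [Sum.elim_inr]
          rw [abs_of_nonneg (integral_nonneg fun _ => abs_nonneg _)]
          refine ((Γ.integral_abs_le_normL1 _ e).trans (hC n)).trans ?_
          nlinarith [mul_nonneg hN0.le h0])
    set c₁ : V → ℝ := fun v => w (Sum.inl v) with hc₁
    set τ : E → ℝ := fun e => w (Sum.inr e) with hτ
    have hcl : ∀ v, Tendsto (fun n => c (φ n) v) atTop (𝓝 (c₁ v)) := fun v => hw (Sum.inl v)
    have hτl : ∀ e, Tendsto (fun n => ∫ x, |u' (q (φ n)) e x| ∂(Γ.edgeMeasure e)) atTop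
        (𝓝 (τ e)) := fun e => hw (Sum.inr e)
    have hτ0 : ∀ e, 0 ≤ τ e := fun e =>
      ge_of_tendsto' (hτl e) fun n => integral_nonneg fun _ => abs_nonneg _
    have hτsum : ∑ e, τ e ≤ Γ.cheegerValue D :=
      le_of_tendsto_of_tendsto' (tendsto_finsetSum _ fun e _ => hτl e)
        ((hseq q hq1 hqt).comp hφ.tendsto_atTop) fun n => hT _ (hq1 _)
    have hmem : ∀ j, Γ.MemL1 (u (q j)) := fun j => (hadm _ (hq1 j)).memL1
    have hTV : Γ.totalVariation u₁ c₁ ≤ ENNReal.ofReal (∑ e, τ e) := by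
      rw [ENNReal.ofReal_sum_of_nonneg fun e _ => hτ0 e]
      exact Finset.sum_le_sum fun e _ => MetricGraph.lineVariation_edgeExtension_le_of_tendsto
        (fun n => hmem (φ n)) hu₁ (hconv.comp hφ.tendsto_atTop) hcl
        (fun n => integral_nonneg fun _ => abs_nonneg _) (hτl e) e
        fun n => (hadm _ (hq1 _)).totalVariation_le (hq1 _).le (hc _) e
    -- Strong convergence preserves the normalization, so the limit is nonzero.
    have hnorm : Γ.normL1 u₁ = 1 := by
      have h1 : ∀ j, 1 - Γ.normL1 u₁ ≤ Γ.normL1 (u (q j) - u₁) := fun j => by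
        have := Γ.normL1_le_add (hmem j) hu₁
        rw [(hu _ (hq1 j)).2] at this
        linarith
      have h2 : ∀ j, Γ.normL1 u₁ - 1 ≤ Γ.normL1 (u (q j) - u₁) := fun j => by
        have := Γ.normL1_le_add hu₁ (hmem j)
        rw [(hu _ (hq1 j)).2, Γ.normL1_sub_comm] at this
        linarith
      linarith [ge_of_tendsto' hconv h1, ge_of_tendsto' hconv h2]
    have hBV : Γ.IsAdmissibleBV D u₁ c₁ := by
      refine ⟨hu₁, hTV.trans_lt ENNReal.ofReal_lt_top, fun v hv => ?_, ?_⟩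
      · refine tendsto_nhds_unique (hcl v) ?_
        simp only [hcD _ v hv, tendsto_const_nhds]
      · by_contra! hcon
        refine one_ne_zero (hnorm.symm.trans (Finset.sum_eq_zero fun e _ => ?_))
        refine integral_eq_zero_of_ae ?_
        filter_upwards [hcon e] with x hx
        simp [hx]
    refine ⟨c₁, hBV, le_antisymm ?_ hBV.cheegerValue_le⟩
    rw [hnorm, div_one]
    exact (ENNReal.toReal_le_of_le_ofReal (Finset.sum_nonneg fun e _ => hτ0 e) hTV).trans hτsum
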